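/- **Setting.** Let $(\mathcal X,\mathcal A,\mu_X)$ and $(\mathcal Y,\mathcal B,\mu_Y)$ be separable $\sigma$-finite measure spaces, $\mu=\mu_X\otimes\mu_Y$, and let $(p^X_j)_{j\in\mathcal J}$, $(p^Y_k)_{k\in\mathcal K}$ be (countable) orthonormal bases of $L^2(\mu_X)$, $L^2(\mu_Y)$, consisting of measurable real functions; put $p_{jk}(x,y)=p_j^X(x)p_k^Y(y)$. Let $\mathcal F$ be the set of measurable $f\in L^2(\mu)$ with $f\ge 0$ $\mu$-a.e. and $\int f\,d\mu=1$. For $f\in\mathcal F$ let $f_X(x)=\int f(x,y)\,d\mu_Y(y)$, $f_Y(y)=\int f(x,y)\,d\mu_X(x)$, $a_{jk}=\int f p_{jk}\,d\mu$, $a_{j\bullet}=\int f_Xp^X_j\,d\mu_X$, $a_{\bullet k}=\int f_Yp^Y_k\,d\mu_Y$, $$D(f)=\int (f-f_Xf_Y)^2\,d\mu,\qquad S_\theta(f)=\sum_{j,k}\theta_{jk}^2(a_{jk}-a_{j\bullet}a_{\bullet k})^2\quad(\theta\in[0,\infty]^{\mathcal J\times\mathcal K},\ \infty\cdot0=0).$$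 For $r>0$, $A\ge1$, $\rho>0$ let $$\mathcal F_{(\theta,r,A)}(\rho)=\{f\in\mathcal F: D(f)\ge\rho^2,\ S_\theta(f)\le r^2,\ \max(\|f\|_\infty,\|f_X\|_\infty,\|f_Y\|_\infty)\le A\},$$ where $\|\cdot\|_\infty$ is the pointwise supremum norm. Write $\mathbb N=\{1,2,\dots\}$. For an injective $\omega:\mathbb N\to\mathcal J\times\mathcal K$ and $\theta_0>0$, let $\Theta(\omega,\theta_0)$ be the set of $\theta$ such that $\omega$ is a bijection from $\mathbb N$ onto $\{(j,k):\theta_{jk}<\infty\}$ and $\theta_0\le\theta_{\omega(1)}\le\theta_{\omega(2)}\le\cdots$, and put $m_0(t)=\min\{m\in\mathbb N: m^{1/2}\theta_{\omega(m)}^2>t\}$. **Test.** For finite $\mathcal M\subseteq\mathcal J\times\mathcal K$ let $$h\bigl((x_1,y_1),\dots,(x_4,y_4)\bigr)=\sum_{(j,k)\in\mathcal M}\{p_{jk}(x_1,y_1)p_{jk}(x_2,y_2)-2p_{jk}(x_1,y_1)p_{jk}(x_2,y_3)+p_{jk}(x_1,y_2)p_{jk}(x_3,y_4)\},$$ and for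 a sample $z=(z_1,\dots,z_n)$, $z_i=(x_i,y_i)$, let $\hat D^{\mathcal M}(z)=\frac1{4!\binom n4}\sum h(z_{i_1},\dots,z_{i_4})$, the sum running over all quadruples of distinct indices in $[n]=\{1,\dots,n\}$. For a permutation $\sigma$ of $[n]$ let $z^{(\sigma)}=((x_i,y_{\sigma(i)}))_{i\in[n]}$. Given permutations $\Pi_1,\dots,\Pi_B$, the p-value is $$P^{\mathcal M}=\frac{1+\sum_{b=1}^B\mathbf 1\{\hat D^{\mathcal M}(z)\le\hat D^{\mathcal M}(z^{(\Pi_b)})\}}{1+B}.$$ Let $\gamma=\lceil2\log_2n\rceil$. The adaptive test computes, for each $i\in[\gamma]$, the p-value $p^{(i)}$ with $\mathcal M=\{\omega(1),\dots,\omega(2^i)\}$ from $B$ independent uniformly random permutations that are independent of the data (the permutations used for different $i$ may be dependent in any way, for instance identical or independent), and rejects $H_0$ if $\min_{i\in[\gamma]}p^{(i)}<\alpha/\gamma$. **Proposition.** Let $\alpha\in(0,1)$, $\beta\in(0,1-\alpha)$, $R_0>0$, $\theta_0>0$, $A\ge1$. There exists $C=C(\alpha,\beta,R_0,\theta_0,A)>0$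 such that for all spaces, bases and $\omega$ as above, all $\theta\in\Theta(\omega,\theta_0)$, $r\in(0,R_0]$, $\rho>0$, all $f\in\mathcal F_{(\theta,r,A)}(\rho)$, all integers $n\ge C$ and $B\ge2\bigl(\frac{\gamma}{\alpha\beta}-1\bigr)$ with $$\rho\ge C\max\Bigl\{\frac{\log^{1/4}n}{n^{1/2}}\,m_0^{1/4}\Bigl(\frac{nr^2}{\log^{1/2}n}\Bigr),\ \frac{\log^{1/2}n}{n^{1/2}}\Bigr\},$$ the adaptive test, applied to $n$ independent observations with density $f$ with respect to $\mu$, rejects $H_0$ with probability at least $1-\beta$. -/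

import Mathlib

open MeasureTheory ProbabilityTheory
open scoped ENNReal

namespace USP

noncomputable section

/-- The finite set of permutations of `[n]` carries the discrete sigma-algebra. -/
instance instMeasurableSpacePerm (n : ℕ) : MeasurableSpace (Equiv.Perm (Fin n)) := ⊤

/-- The (genuine, measurable) functions `p j` form an orthonormal basis of `L²(μ)`. -/
def IsONBasisL2 {S ι : Type*} [MeasurableSpace S] (μ : Measure S) (p : ι → S → ℝ) : Prop :=
  (∀ j, Measurable (p j)) ∧
    ∃ b : HilbertBasis ι ℝ (Lp ℝ 2 μ), ∀ j, (b j : S → ℝ) =ᵐ[μ] p j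

/-- The pointwise supremum norm, with values in `[0, ∞]`. -/
def supNorm {S : Type*} (g : S → ℝ) : ℝ≥0∞ := ⨆ s, ‖g s‖ₑ

section Densities

variable {𝒳 𝒴 J K : Type*} [MeasurableSpace 𝒳] [MeasurableSpace 𝒴]

/-- Square-integrable probability densities with respect to `μX ⊗ μY`. -/
structure IsDensity (μX : Measure 𝒳) (μY : Measure 𝒴) (f : 𝒳 × 𝒴 → ℝ) : Prop where
  measurable : Measurable f
  memLp : MemLp f 2 (μX.prod μY)
  nonneg : ∀ᵐ z ∂(μX.prod μY), 0 ≤ f z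
  integral_eq_one : ∫ z, f z ∂(μX.prod μY) = 1

/-- The marginal density `f_X`. -/
def marginalX (μY : Measure 𝒴) (f : 𝒳 × 𝒴 → ℝ) (x : 𝒳) : ℝ := ∫ y, f (x, y) ∂μY

/-- The marginal density `f_Y`. -/
def marginalY (μX : Measure 𝒳) (f : 𝒳 × 𝒴 → ℝ) (y : 𝒴) : ℝ := ∫ x, f (x, y) ∂μX

/-- The product basis `p_{jk}(x, y) = p_j^X(x) p_k^Y(y)`. -/
def prodBasis (pX : J → 𝒳 → ℝ) (pY : K → 𝒴 → ℝ) (jk : J × K) (z : 𝒳 × 𝒴) : ℝ :=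
  pX jk.1 z.1 * pY jk.2 z.2

/-- The coefficient `a_{jk}(f)`. -/
def coeff (μX : Measure 𝒳) (μY : Measure 𝒴) (pX : J → 𝒳 → ℝ) (pY : K → 𝒴 → ℝ)
    (f : 𝒳 × 𝒴 → ℝ) (jk : J × K) : ℝ :=
  ∫ z, f z * prodBasis pX pY jk z ∂(μX.prod μY)

/-- The coefficient of `f_X` on `p_j^X`. -/
def coeffX (μX : Measure 𝒳) (μY : Measure 𝒴) (pX : J → 𝒳 → ℝ) (f : 𝒳 × 𝒴 → ℝ) (j : J) : ℝ :=
  ∫ x, marginalX μY f x * pX j x ∂μX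

/-- The coefficient of `f_Y` on `p_k^Y`. -/
def coeffY (μX : Measure 𝒳) (μY : Measure 𝒴) (pY : K → 𝒴 → ℝ) (f : 𝒳 × 𝒴 → ℝ) (k : K) : ℝ :=
  ∫ y, marginalY μX f y * pY k y ∂μY

/-- The measure of dependence `D(f)`, the squared `L²` distance from `f` to `f_X f_Y`. -/
def dependence (μX : Measure 𝒳) (μY : Measure 𝒴) (f : 𝒳 × 𝒴 → ℝ) : ℝ :=
  ∫ z, (f z - marginalX μY f z.1 * marginalY μX f z.2) ^ 2 ∂(μX.prod μY)

/-- The smoothness functional `S_θ(f)`, with values in `[0, ∞]` and the convention `∞ * 0 = 0`. -/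
def smoothness (μX : Measure 𝒳) (μY : Measure 𝒴) (pX : J → 𝒳 → ℝ) (pY : K → 𝒴 → ℝ)
    (θ : J × K → ℝ≥0∞) (f : 𝒳 × 𝒴 → ℝ) : ℝ≥0∞ :=
  ∑' jk : J × K, θ jk ^ 2 *
    ENNReal.ofReal
      ((coeff μX μY pX pY f jk - coeffX μX μY pX f jk.1 * coeffY μX μY pY f jk.2) ^ 2)

/-- The space of alternatives `𝓕_ξ(ρ)` with `ξ = (θ, r, A)`. -/
structure IsAlternative (μX : Measure 𝒳) (μY : Measure 𝒴) (pX : J → 𝒳 → ℝ) (pY : K → 𝒴 → ℝ)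
    (θ : J × K → ℝ≥0∞) (r A ρ : ℝ) (f : 𝒳 × 𝒴 → ℝ) : Prop where
  isDensity : IsDensity μX μY f
  le_dependence : ρ ^ 2 ≤ dependence μX μY f
  smoothness_le : smoothness μX μY pX pY θ f ≤ ENNReal.ofReal (r ^ 2)
  supNorm_le : supNorm f ≤ ENNReal.ofReal A
  supNorm_marginalX_le : supNorm (marginalX μY f) ≤ ENNReal.ofReal A
  supNorm_marginalY_le : supNorm (marginalY μX f) ≤ ENNReal.ofReal A

end Densities

section Ordering

variable {J K : Type*}

/-- The class `Θ(ω, θ₀)` of weight arrays whose finite entries are enumerated in increasing order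
by `ω(1), ω(2), …` and are bounded below by `θ₀`. -/
structure IsOrderedWeight (ω : ℕ+ ↪ J × K) (θ₀ : ℝ) (θ : J × K → ℝ≥0∞) : Prop where
  bijOn : Set.BijOn ω Set.univ {jk | θ jk < ∞}
  le_first : ENNReal.ofReal θ₀ ≤ θ (ω 1)
  mono : Monotone fun m : ℕ+ => θ (ω m)

/-- `m₀(t) = min {m ∈ {1, 2, …} : m^{1/2} θ_{ω(m)}² > t}`. -/
def m₀ (ω : ℕ+ ↪ J × K) (θ : J × K → ℝ≥0∞) (t : ℝ) : ℕ :=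
  sInf {m : ℕ | ∃ k : ℕ+, (k : ℕ) = m ∧
    ENNReal.ofReal t < ENNReal.ofReal (Real.sqrt m) * θ (ω k) ^ 2}

/-- The truncation set `{ω(1), …, ω(m)}`. -/
def truncationSet (ω : ℕ+ ↪ J × K) (m : ℕ+) : Finset (J × K) := (Finset.Icc 1 m).map ω

/-- `γ = ⌈2 log₂ n⌉`. -/
def numTests (n : ℕ) : ℕ := ⌈2 * Real.logb 2 n⌉₊

end Ordering

section Tests

variable {𝒳 𝒴 J K : Type*}

/-- The kernel `h` of the U-statistic with truncation set `M`. -/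
def kernel (pX : J → 𝒳 → ℝ) (pY : K → 𝒴 → ℝ) (M : Finset (J × K)) (z₁ z₂ z₃ z₄ : 𝒳 × 𝒴) : ℝ :=
  ∑ jk ∈ M,
    (prodBasis pX pY jk (z₁.1, z₁.2) * prodBasis pX pY jk (z₂.1, z₂.2)
      - 2 * (prodBasis pX pY jk (z₁.1, z₁.2) * prodBasis pX pY jk (z₂.1, z₃.2))
      + prodBasis pX pY jk (z₁.1, z₂.2) * prodBasis pX pY jk (z₃.1, z₄.2))

/-- The U-statistic of order four based on the sample `z₁, …, z_n`; the sum runs over all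
quadruples of distinct indices. -/
def Dhat (pX : J → 𝒳 → ℝ) (pY : K → 𝒴 → ℝ) (M : Finset (J × K)) {n : ℕ}
    (z : Fin n → 𝒳 × 𝒴) : ℝ :=
  1 / ((Nat.factorial 4 : ℝ) * (n.choose 4 : ℝ)) *
    ∑ i : Fin 4 ↪ Fin n, kernel pX pY M (z (i 0)) (z (i 1)) (z (i 2)) (z (i 3))

/-- The permuted sample `(x_i, y_{σ(i)})`. -/
def permute {n : ℕ} (σ : Equiv.Perm (Fin n)) (z : Fin n → 𝒳 × 𝒴) : Fin n → 𝒳 × 𝒴 :=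
  fun i => ((z i).1, (z (σ i)).2)

/-- The permutation p-value computed from the sample `z` and the permutations `π₁, …, π_B`. -/
def pValue (pX : J → 𝒳 → ℝ) (pY : K → 𝒴 → ℝ) (M : Finset (J × K)) {n B : ℕ}
    (z : Fin n → 𝒳 × 𝒴) (π : Fin B → Equiv.Perm (Fin n)) : ℝ :=
  (1 + ∑ b : Fin B,
      Set.indicator {σ | Dhat pX pY M z ≤ Dhat pX pY M (permute σ z)} (fun _ => (1 : ℝ)) (π b))
    / (1 + (B : ℝ))

/-- The adaptive (Bonferroni) test rejects: `min_{i ∈ [γ]} p^{(i)} < α / γ`, where `p^{(i)}` is the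
p-value for the truncation set `{ω(1), …, ω(2^i)}`, computed with the permutations `π i`. -/
def AdaptiveReject (pX : J → 𝒳 → ℝ) (pY : K → 𝒴 → ℝ) (ω : ℕ+ ↪ J × K) (α : ℝ) {n B : ℕ}
    (z : Fin n → 𝒳 × 𝒴) (π : ℕ → Fin B → Equiv.Perm (Fin n)) : Prop :=
  ∃ i ∈ Finset.Icc 1 (numTests n),
    pValue pX pY (truncationSet ω (2 ^ i)) z (π i) < α / (numTests n : ℝ)

end Tests

section Sampling

variable {Ω 𝒳 𝒴 : Type*} [MeasurableSpace Ω] [MeasurableSpace 𝒳] [MeasurableSpace 𝒴]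

/-- `Z₁, …, Z_n` are independent with density `f` with respect to `μX ⊗ μY`. -/
structure IsIIDSample (P : Measure Ω) (μX : Measure 𝒳) (μY : Measure 𝒴) (f : 𝒳 × 𝒴 → ℝ)
    {n : ℕ} (Z : Fin n → Ω → 𝒳 × 𝒴) : Prop where
  measurable : ∀ k, Measurable (Z k)
  law : ∀ k, P.map (Z k) = (μX.prod μY).withDensity fun z => ENNReal.ofReal (f z)
  indep : iIndepFun Z P

/-- `Π₁, …, Π_B` are independent uniform random permutations of `[n]`, jointly independent of the
sample `Z`. -/
structure IsUniformPerms (P : Measure Ω) {n B : ℕ} (Z : Fin n → Ω → 𝒳 × 𝒴)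
    (π : Fin B → Ω → Equiv.Perm (Fin n)) : Prop where
  measurable : ∀ b, Measurable (π b)
  uniform : ∀ b σ, P {w | π b w = σ} = 1 / (Nat.factorial n : ℝ≥0∞)
  indep : iIndepFun π P
  indep_sample : IndepFun (fun w k => Z k w) (fun w b => π b w) P

end Sampling

end

end USP

/-! Only one of the tests has to reject, so it is enough to find a level `i` whose p-value falls
below α/γ with probability at least 1 - β. The price of adaptation is the threshold α/γ, with γ of
order log n.

Fix a truncation set M and write c for the coefficients of f - f_X f_Y and D_M for the sum of c²
over M. After symmetrisation `Dhat` is the U-statistic whose kernel sums g(z₁,z₂) g(z₃,z₄) over M,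
where g is the unbiased kernel of a covariance (`Dhat_eq_sum_covQuad`). Two estimates carry the
proof, both with constants depending on A only. (a) On the original sample, `Dhat` is within mean
squared error D_M/n + |M|/n² of D_M (`integral_Dhat_sub_sq_le`): the linear term of a Hoeffding-type
decomposition has variance proportional to D_M, and orthonormality makes the doubly centred term
cost |M| instead of |M|². (b) On a randomly permuted sample, `Dhat` has second moment |M|/n²
(`sum_perm_integral_Dhat_sq_le`): exchanging two values of the permutation flips the sign of one
covariance kernel, so most cross terms cancel whatever the data are. By Chebyshev's inequality at
D_M/2, a permuted statistic reaches the original one with probability q of order 1/(n D_M) + |M|/(n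
D_M)². Markov's inequality for the p-value then requires γ q to be small and B to be at least of
order γ.

It remains to choose M. A dyadic level 2^i between m₀ and 2 m₀ exists because m₀ ≤ n² ≤ 2^γ. The
definition of m₀ and the smoothness bound give a truncation loss of at most √(m₀ log n)/n, which the
separation condition makes at most ρ²/2, so D_M ≥ ρ²/2 (`IsAlternative.dependence_le`). The two
terms of the maximum in that condition are what make |M|/(n D_M)² and 1/(n D_M) smaller than a
multiple of 1/log n (`exceedance_bound`). -/

namespace USP

noncomputable section

set_option linter.unusedSectionVars false

/-! ### Square-integrability, orthonormality and Parseval's identity in one factor. -/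

section SquareIntegrable

variable {S : Type*} [MeasurableSpace S] {ν : Measure S}

/-- A bound on the upper integral of the square gives square-integrability and a moment bound. -/
theorem memLp_two_and_integral_sq_le {g : S → ℝ} {c : ℝ} (hg : AEStronglyMeasurable g ν)
    (hc : 0 ≤ c) (h : ∫⁻ s, ENNReal.ofReal (g s ^ 2) ∂ν ≤ ENNReal.ofReal c) :
    MemLp g 2 ν ∧ ∫ s, g s ^ 2 ∂ν ≤ c := by
  have hm : AEStronglyMeasurable (fun s => g s ^ 2) ν := hg.pow 2
  have hi : Integrable (fun s => g s ^ 2) ν := by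
    refine ⟨hm, ?_⟩
    rw [hasFiniteIntegral_iff_ofReal (Filter.Eventually.of_forall fun s => sq_nonneg _)]
    exact h.trans_lt ENNReal.ofReal_lt_top
  refine ⟨(memLp_two_iff_integrable_sq hg).2 hi, ?_⟩
  rw [← ofReal_integral_eq_lintegral_ofReal hi
    (Filter.Eventually.of_forall fun s => sq_nonneg _)] at h
  exact (ENNReal.ofReal_le_ofReal_iff hc).1 h

theorem lintegral_ofReal_sq {g : S → ℝ} (hg : MemLp g 2 ν) :
    ∫⁻ s, ENNReal.ofReal (g s ^ 2) ∂ν = ENNReal.ofReal (∫ s, g s ^ 2 ∂ν) :=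
  (ofReal_integral_eq_lintegral_ofReal hg.integrable_sq
    (Filter.Eventually.of_forall fun _ => sq_nonneg _)).symm

theorem IsONBasisL2.memLp {ι : Type*} {p : ι → S → ℝ} (h : IsONBasisL2 ν p) (j : ι) :
    MemLp (p j) 2 ν := by
  obtain ⟨b, hb⟩ := h.2
  exact (memLp_congr_ae (hb j)).1 (Lp.memLp (b j))

theorem IsONBasisL2.integral_mul {ι : Type*} [DecidableEq ι] {p : ι → S → ℝ}
    (h : IsONBasisL2 ν p) (i j : ι) : ∫ s, p i s * p j s ∂ν = if i = j then 1 else 0 := by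
  obtain ⟨b, hb⟩ := h.2
  have h1 := (orthonormal_iff_ite.1 b.orthonormal) i j
  rw [L2.inner_def] at h1
  rw [← h1]
  refine integral_congr_ae ?_
  filter_upwards [hb i, hb j] with s hi hj
  simp [hi, hj, mul_comm]

/-- Parseval's identity with values in `[0, ∞]`. -/
theorem IsONBasisL2.tsum_ofReal_sq {ι : Type*} {p : ι → S → ℝ}
    (h : IsONBasisL2 ν p) {g : S → ℝ} (hg : MemLp g 2 ν) :
    ∑' j, ENNReal.ofReal ((∫ s, g s * p j s ∂ν) ^ 2) = ∫⁻ s, ENNReal.ofReal (g s ^ 2) ∂ν := by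
  obtain ⟨b, hb⟩ := h.2
  have h1 := b.hasSum_inner_mul_inner (hg.toLp g) (hg.toLp g)
  have h2 : ∀ j, inner ℝ (hg.toLp g) (b j) = ∫ s, g s * p j s ∂ν := by
    intro j
    rw [L2.inner_def]
    refine integral_congr_ae ?_
    filter_upwards [hb j, hg.coeFn_toLp] with s hj hs
    simp [hj, hs, mul_comm]
  have h3 : inner ℝ (hg.toLp g) (hg.toLp g) = ∫ s, g s ^ 2 ∂ν := by
    rw [L2.inner_def]
    refine integral_congr_ae ?_
    filter_upwards [hg.coeFn_toLp] with s hs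
    simp [hs, sq]
  rw [h3] at h1
  have h4 : HasSum (fun j => (∫ s, g s * p j s ∂ν) ^ 2) (∫ s, g s ^ 2 ∂ν) := by
    convert! h1 using 2 with j
    rw [real_inner_comm (hg.toLp g) (b j), h2, sq]
  rw [lintegral_ofReal_sq hg, ← h4.tsum_eq,
    ENNReal.ofReal_tsum_of_nonneg (fun _ => sq_nonneg _) h4.summable]

end SquareIntegrable

/-! ### Orthonormality and Parseval's identity for the product basis. -/

section ProductBasis

variable {𝒳 𝒴 J K : Type*} [MeasurableSpace 𝒳] [MeasurableSpace 𝒴]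
  {μX : Measure 𝒳} {μY : Measure 𝒴} [SigmaFinite μX] [SigmaFinite μY]
  {pX : J → 𝒳 → ℝ} {pY : K → 𝒴 → ℝ}

theorem measurable_prodBasis (hX : IsONBasisL2 μX pX) (hY : IsONBasisL2 μY pY) (jk : J × K) :
    Measurable (prodBasis pX pY jk) :=
  ((hX.1 jk.1).comp measurable_fst).mul ((hY.1 jk.2).comp measurable_snd)

theorem memLp_prodBasis (hX : IsONBasisL2 μX pX) (hY : IsONBasisL2 μY pY) (jk : J × K) :
    MemLp (prodBasis pX pY jk) 2 (μX.prod μY) := by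
  rw [memLp_two_iff_integrable_sq (measurable_prodBasis hX hY jk).aestronglyMeasurable]
  simpa only [prodBasis, mul_pow] using
    (hX.memLp jk.1).integrable_sq.mul_prod (hY.memLp jk.2).integrable_sq

theorem integral_prodBasis_mul [DecidableEq J] [DecidableEq K] (hX : IsONBasisL2 μX pX)
    (hY : IsONBasisL2 μY pY) (a b : J × K) :
    ∫ z, prodBasis pX pY a z * prodBasis pX pY b z ∂(μX.prod μY) = if a = b then 1 else 0 := by
  have h := integral_prod_mul (μ := μX) (ν := μY) (fun x => pX a.1 x * pX b.1 x)
    (fun y => pY a.2 y * pY b.2 y)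
  rw [hX.integral_mul, hY.integral_mul] at h
  have h2 : (fun z : 𝒳 × 𝒴 => prodBasis pX pY a z * prodBasis pX pY b z) =
      fun z => (pX a.1 z.1 * pX b.1 z.1) * (pY a.2 z.2 * pY b.2 z.2) := by
    funext z
    simp only [prodBasis]
    ring
  rw [h2, h]
  by_cases h1 : a.1 = b.1 <;> by_cases h2 : a.2 = b.2 <;> simp [Prod.ext_iff, h1, h2]

theorem memLp_sum_prodBasis (hX : IsONBasisL2 μX pX) (hY : IsONBasisL2 μY pY)
    (M : Finset (J × K)) (c : J × K → ℝ) :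
    MemLp (fun z => ∑ jk ∈ M, c jk * prodBasis pX pY jk z) 2 (μX.prod μY) :=
  memLp_finsetSum M fun jk _ => (memLp_prodBasis hX hY jk).const_mul (c jk)

/-- Orthonormality of the product system, for finite linear combinations. -/
theorem lintegral_sum_prodBasis_sq (hX : IsONBasisL2 μX pX) (hY : IsONBasisL2 μY pY)
    (M : Finset (J × K)) (c : J × K → ℝ) :
    ∫⁻ z, ENNReal.ofReal ((∑ jk ∈ M, c jk * prodBasis pX pY jk z) ^ 2) ∂(μX.prod μY) =
      ENNReal.ofReal (∑ jk ∈ M, c jk ^ 2) := by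
  classical
  rw [lintegral_ofReal_sq (memLp_sum_prodBasis hX hY M c)]
  congr 1
  have hi : ∀ a b, Integrable (fun z => (c a * prodBasis pX pY a z) * (c b * prodBasis pX pY b z))
      (μX.prod μY) := fun a b =>
    ((memLp_prodBasis hX hY a).const_mul (c a)).integrable_mul
      ((memLp_prodBasis hX hY b).const_mul (c b))
  simp_rw [sq, Finset.sum_mul_sum]
  rw [integral_finsetSum _ fun a _ => integrable_finsetSum _ fun b _ => hi a b]
  refine Finset.sum_congr rfl fun a ha => ?_
  rw [integral_finsetSum _ fun b _ => hi a b]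
  have h1 : ∀ b, ∫ z, (c a * prodBasis pX pY a z) * (c b * prodBasis pX pY b z) ∂(μX.prod μY) =
      if a = b then c a * c b else 0 := by
    intro b
    simp_rw [mul_mul_mul_comm (c a)]
    rw [integral_const_mul, integral_prodBasis_mul hX hY]
    split_ifs <;> simp
  simp_rw [h1]
  simp [ha]

/-- Parseval's identity for the product basis. -/
theorem tsum_ofReal_sq_prodBasis [Countable K] (hX : IsONBasisL2 μX pX) (hY : IsONBasisL2 μY pY)
    {g : 𝒳 × 𝒴 → ℝ} (hgm : Measurable g) (hg : MemLp g 2 (μX.prod μY)) :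
    ∑' jk : J × K, ENNReal.ofReal ((∫ z, g z * prodBasis pX pY jk z ∂(μX.prod μY)) ^ 2) =
      ∫⁻ z, ENNReal.ofReal (g z ^ 2) ∂(μX.prod μY) := by
  -- Parseval in y holds on almost every slice. Integrating over x and applying Parseval in x to
  -- each coefficient function gives the product identity without constructing a Hilbert basis of
  -- the product space.
  have hslice : ∀ᵐ x ∂μX, ∑' k, ENNReal.ofReal ((∫ y, g (x, y) * pY k y ∂μY) ^ 2) =
      ∫⁻ y, ENNReal.ofReal (g (x, y) ^ 2) ∂μY := by
    filter_upwards [hg.integrable_sq.prod_right_ae] with x hx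
    have hx2 : MemLp (fun y => g (x, y)) 2 μY :=
      (memLp_two_iff_integrable_sq
        (hgm.comp measurable_prodMk_left).aestronglyMeasurable).2 hx
    exact hY.tsum_ofReal_sq hx2
  have hcm : ∀ k, StronglyMeasurable fun x => ∫ y, g (x, y) * pY k y ∂μY := fun k =>
    StronglyMeasurable.integral_prod_right
      (f := fun x y => g (x, y) * pY k y) (hgm.mul ((hY.1 k).comp measurable_snd)).stronglyMeasurable
  have htot : ∑' k, ∫⁻ x, ENNReal.ofReal ((∫ y, g (x, y) * pY k y ∂μY) ^ 2) ∂μX =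
      ∫⁻ z, ENNReal.ofReal (g z ^ 2) ∂(μX.prod μY) := by
    rw [← lintegral_tsum fun k => ((hcm k).measurable.pow_const 2).ennreal_ofReal.aemeasurable,
      lintegral_congr_ae hslice,
      lintegral_prod _ (hgm.pow_const 2).ennreal_ofReal.aemeasurable]
  have hfin : ∫⁻ z, ENNReal.ofReal (g z ^ 2) ∂(μX.prod μY) ≠ ∞ := by
    rw [lintegral_ofReal_sq hg]
    exact ENNReal.ofReal_ne_top
  -- Each coefficient function is square-integrable because its squared norm is one term of the
  -- finite sum `htot`.
  have hc2 : ∀ k, MemLp (fun x => ∫ y, g (x, y) * pY k y ∂μY) 2 μX := by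
    intro k
    have h1 : ∫⁻ x, ENNReal.ofReal ((∫ y, g (x, y) * pY k y ∂μY) ^ 2) ∂μX ≠ ∞ :=
      ne_top_of_le_ne_top (htot ▸ hfin) (ENNReal.le_tsum k)
    exact (memLp_two_and_integral_sq_le (hcm k).aestronglyMeasurable ENNReal.toReal_nonneg
      (ENNReal.ofReal_toReal h1).ge).1
  rw [ENNReal.tsum_prod', ENNReal.tsum_comm, ← htot]
  refine tsum_congr fun k => ?_
  rw [← hX.tsum_ofReal_sq (hc2 k)]
  refine tsum_congr fun j => ?_
  have hint : Integrable (fun z => g z * prodBasis pX pY (j, k) z) (μX.prod μY) :=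
    hg.integrable_mul (memLp_prodBasis hX hY (j, k))
  rw [integral_prod _ hint]
  congr 3
  funext x
  rw [← integral_mul_const]
  congr 1
  funext y
  simp only [prodBasis]
  ring

end ProductBasis

/-! ### Marginal densities. -/

section Marginals

variable {𝒳 𝒴 J K : Type*} [MeasurableSpace 𝒳] [MeasurableSpace 𝒴]
  {μX : Measure 𝒳} {μY : Measure 𝒴} [SigmaFinite μX] [SigmaFinite μY]
  {pX : J → 𝒳 → ℝ} {pY : K → 𝒴 → ℝ} {f : 𝒳 × 𝒴 → ℝ} {A : ℝ}

theorem abs_le_of_supNorm_le {S : Type*} {g : S → ℝ} (hA : 0 ≤ A)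
    (h : supNorm g ≤ ENNReal.ofReal A) (s : S) : |g s| ≤ A := by
  have h1 : ‖g s‖ₑ ≤ ENNReal.ofReal A := (le_iSup (fun s => ‖g s‖ₑ) s).trans h
  rw [Real.enorm_eq_ofReal_abs] at h1
  exact (ENNReal.ofReal_le_ofReal_iff hA).1 h1

theorem IsDensity.integrable (h : IsDensity μX μY f) : Integrable f (μX.prod μY) := by
  by_contra hf
  have := h.integral_eq_one
  rw [integral_undef hf] at this
  exact zero_ne_one this

theorem IsDensity.measurable_marginalX (h : IsDensity μX μY f) :
    Measurable (marginalX μY f) :=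
  (StronglyMeasurable.integral_prod_right (f := fun x y => f (x, y))
    h.measurable.stronglyMeasurable).measurable

theorem IsDensity.measurable_marginalY (h : IsDensity μX μY f) :
    Measurable (marginalY μX f) :=
  (StronglyMeasurable.integral_prod_left (f := fun x y => f (x, y))
    h.measurable.stronglyMeasurable).measurable

theorem IsDensity.lintegral_marginalX (h : IsDensity μX μY f) :
    ∀ᵐ x ∂μX, ∫⁻ y, ENNReal.ofReal (f (x, y)) ∂μY = ENNReal.ofReal (marginalX μY f x) := by
  filter_upwards [h.integrable.prod_right_ae, Measure.ae_ae_of_ae_prod h.nonneg] with x h1 h2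
  exact (ofReal_integral_eq_lintegral_ofReal h1 h2).symm

theorem IsDensity.lintegral_marginalY (h : IsDensity μX μY f) :
    ∀ᵐ y ∂μY, ∫⁻ x, ENNReal.ofReal (f (x, y)) ∂μX = ENNReal.ofReal (marginalY μX f y) := by
  have h0 : ∀ᵐ w ∂(μY.prod μX), 0 ≤ f w.swap :=
    (Measure.measurePreserving_swap (μ := μY) (ν := μX)).quasiMeasurePreserving.ae h.nonneg
  filter_upwards [h.integrable.prod_left_ae, Measure.ae_ae_of_ae_prod h0] with y h1 h2
  exact (ofReal_integral_eq_lintegral_ofReal h1 h2).symm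

theorem memLp_two_of_bounded {S : Type*} [MeasurableSpace S] {ν : Measure S} {g : S → ℝ}
    (hg : Integrable g ν) (hb : ∀ s, |g s| ≤ A) : MemLp g 2 ν := by
  rw [memLp_two_iff_integrable_sq hg.1]
  simp_rw [sq]
  exact hg.bdd_mul hg.1 (Filter.Eventually.of_forall hb)

end Marginals

/-! ### Second moments of forms in the product basis evaluated at the sample. -/

section Sample

variable {Ω 𝒳 𝒴 J K : Type*} [MeasurableSpace Ω] [MeasurableSpace 𝒳] [MeasurableSpace 𝒴]
  {P : Measure Ω} [IsProbabilityMeasure P]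
  {μX : Measure 𝒳} {μY : Measure 𝒴} [SigmaFinite μX] [SigmaFinite μY]
  {pX : J → 𝒳 → ℝ} {pY : K → 𝒴 → ℝ} {f : 𝒳 × 𝒴 → ℝ} {A : ℝ}
  {n : ℕ} {Z : Fin n → Ω → 𝒳 × 𝒴}

/-- An independent sample whose joint and marginal laws have densities bounded by `A`. -/
structure IsDominatedSample (P : Measure Ω) (μX : Measure 𝒳) (μY : Measure 𝒴) (A : ℝ)
    (Z : Fin n → Ω → 𝒳 × 𝒴) : Prop where
  measurable : ∀ k, Measurable (Z k)
  indep : iIndepFun Z P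
  map_le : ∀ k, P.map (Z k) ≤ ENNReal.ofReal A • μX.prod μY
  map_fst_le : ∀ k, P.map (fun w => (Z k w).1) ≤ ENNReal.ofReal A • μX
  map_snd_le : ∀ k, P.map (fun w => (Z k w).2) ≤ ENNReal.ofReal A • μY

/-- Tonelli on the strips `s ×ˢ univ` and `univ ×ˢ s` identifies the marginal laws with the
densities f_X and f_Y, so the three sup-norm bounds become domination of measures. The moment bounds
for linear and bilinear forms rest on this domination and independence alone. -/
theorem IsIIDSample.isDominatedSample (h : IsIIDSample P μX μY f Z) (hf : IsDensity μX μY f)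
    (hA : 0 ≤ A) (hb : supNorm f ≤ ENNReal.ofReal A)
    (hbX : supNorm (marginalX μY f) ≤ ENNReal.ofReal A)
    (hbY : supNorm (marginalY μX f) ≤ ENNReal.ofReal A) :
    IsDominatedSample P μX μY A Z := by
  have hfm : Measurable fun z => ENNReal.ofReal (f z) := hf.measurable.ennreal_ofReal
  refine ⟨h.measurable, h.indep, fun k => ?_, fun k => ?_, fun k => ?_⟩
  · rw [h.law k, ← withDensity_const]
    exact withDensity_mono (Filter.Eventually.of_forall fun z =>
      ENNReal.ofReal_le_ofReal ((le_abs_self _).trans (abs_le_of_supNorm_le hA hb z)))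
  · rw [Measure.le_iff]
    intro s hs
    have h1 : P.map (fun w => (Z k w).1) s = P.map (Z k) (s ×ˢ Set.univ) := by
      rw [Measure.map_apply (f := fun w => (Z k w).1) (measurable_fst.comp (h.measurable k)) hs,
        Measure.map_apply (h.measurable k) (hs.prod MeasurableSet.univ)]
      congr 1
      ext w
      simp
    rw [h1, h.law k, withDensity_apply _ (hs.prod MeasurableSet.univ), ← Measure.prod_restrict,
      lintegral_prod _ hfm.aemeasurable, Measure.restrict_univ, Measure.smul_apply, smul_eq_mul,
      ← setLIntegral_const]
    refine lintegral_mono_ae ?_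
    filter_upwards [ae_restrict_of_ae hf.lintegral_marginalX] with x hx
    rw [hx]
    exact ENNReal.ofReal_le_ofReal ((le_abs_self _).trans (abs_le_of_supNorm_le hA hbX x))
  · rw [Measure.le_iff]
    intro s hs
    have h1 : P.map (fun w => (Z k w).2) s = P.map (Z k) (Set.univ ×ˢ s) := by
      rw [Measure.map_apply (f := fun w => (Z k w).2) (measurable_snd.comp (h.measurable k)) hs,
        Measure.map_apply (h.measurable k) (MeasurableSet.univ.prod hs)]
      congr 1
      ext w
      simp
    rw [h1, h.law k, withDensity_apply _ (MeasurableSet.univ.prod hs), ← Measure.prod_restrict,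
      lintegral_prod_symm _ hfm.aemeasurable, Measure.restrict_univ, Measure.smul_apply,
      smul_eq_mul, ← setLIntegral_const]
    refine lintegral_mono_ae ?_
    filter_upwards [ae_restrict_of_ae hf.lintegral_marginalY] with y hy
    rw [hy]
    exact ENNReal.ofReal_le_ofReal ((le_abs_self _).trans (abs_le_of_supNorm_le hA hbY y))

namespace IsDominatedSample

theorem measurable_pair (h : IsDominatedSample P μX μY A Z) (i j : Fin n) :
    Measurable fun w => ((Z i w).1, (Z j w).2) :=
  (measurable_fst.comp (h.measurable i)).prodMk (measurable_snd.comp (h.measurable j))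

/-- The pair `(X_i, Y_j)` has a density bounded by `A²`, whether or not `i = j`. -/
theorem map_pair_le (h : IsDominatedSample P μX μY A Z) (hA : 1 ≤ A) (i j : Fin n) :
    P.map (fun w => ((Z i w).1, (Z j w).2)) ≤ ENNReal.ofReal (A ^ 2) • μX.prod μY := by
  rcases eq_or_ne i j with rfl | hij
  -- On the diagonal the density is at most A, and A ≤ A² because 1 ≤ A.
  · refine (h.map_le i).trans ?_
    gcongr
    nlinarith
  · have hi : IndepFun (fun w => (Z i w).1) (fun w => (Z j w).2) P :=
      (h.indep.indepFun hij).comp measurable_fst measurable_snd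
    have hmi : Measurable fun w => (Z i w).1 := measurable_fst.comp (h.measurable i)
    have hmj : Measurable fun w => (Z j w).2 := measurable_snd.comp (h.measurable j)
    rw [(indepFun_iff_map_prod_eq_prod_map_map hmi.aemeasurable hmj.aemeasurable).1 hi]
    have : IsProbabilityMeasure (P.map fun w => (Z j w).2) :=
      Measure.isProbabilityMeasure_map hmj.aemeasurable
    have : SFinite (ENNReal.ofReal A • μY) := inferInstance
    refine (Measure.prod_mono (h.map_fst_le i) (h.map_snd_le j)).trans (le_of_eq ?_)
    rw [Measure.prod_smul_left, Measure.prod_smul_right, smul_smul, sq,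
      ENNReal.ofReal_mul (zero_le_one.trans hA)]

theorem lintegral_pair_le (h : IsDominatedSample P μX μY A Z) (hA : 1 ≤ A) (i j : Fin n)
    {g : 𝒳 × 𝒴 → ℝ≥0∞} (hg : Measurable g) :
    ∫⁻ w, g ((Z i w).1, (Z j w).2) ∂P ≤ ENNReal.ofReal (A ^ 2) * ∫⁻ z, g z ∂(μX.prod μY) := by
  rw [← lintegral_map hg (h.measurable_pair i j), ← smul_eq_mul, ← lintegral_smul_measure]
  exact lintegral_mono' (h.map_pair_le hA i j) le_rfl

theorem measurable_linear (hX : IsONBasisL2 μX pX) (hY : IsONBasisL2 μY pY)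
    (M : Finset (J × K)) (c : J × K → ℝ) :
    Measurable fun z => ∑ jk ∈ M, c jk * prodBasis pX pY jk z :=
  Finset.measurable_fun_sum _ fun jk _ => (measurable_prodBasis hX hY jk).const_mul _

/-- Second moments of linear combinations of `p_{jk}(X_a, Y_b)`. -/
theorem linear_moment (h : IsDominatedSample P μX μY A Z) (hA : 1 ≤ A)
    (hX : IsONBasisL2 μX pX) (hY : IsONBasisL2 μY pY) (M : Finset (J × K)) (c : J × K → ℝ)
    (a b : Fin n) :
    MemLp (fun w => ∑ jk ∈ M, c jk * prodBasis pX pY jk ((Z a w).1, (Z b w).2)) 2 P ∧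
      ∫ w, (∑ jk ∈ M, c jk * prodBasis pX pY jk ((Z a w).1, (Z b w).2)) ^ 2 ∂P ≤
        A ^ 2 * ∑ jk ∈ M, c jk ^ 2 := by
  have hm := measurable_linear hX hY M c
  refine memLp_two_and_integral_sq_le
    (hm.comp (h.measurable_pair a b)).aestronglyMeasurable
    (mul_nonneg (sq_nonneg _) (Finset.sum_nonneg fun _ _ => sq_nonneg _)) ?_
  refine (h.lintegral_pair_le hA a b (hm.pow_const 2).ennreal_ofReal).trans ?_
  rw [lintegral_sum_prodBasis_sq hX hY, ENNReal.ofReal_mul (sq_nonneg A)]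

/-- The two pairs are independent. With the first frozen at u the sum is a linear form in the second
with coefficients p_jk(u), so orthonormality leaves the sum of p_jk(u)²; integrating over u gives
one unit per element of M. Each integration costs a factor A². -/
theorem quadratic_moment_of_disjoint (h : IsDominatedSample P μX μY A Z) (hA : 1 ≤ A)
    (hX : IsONBasisL2 μX pX) (hY : IsONBasisL2 μY pY) (M : Finset (J × K))
    {a b c d : Fin n} (hac : a ≠ c) (had : a ≠ d) (hbc : b ≠ c) (hbd : b ≠ d) :
    MemLp (fun w => ∑ jk ∈ M, prodBasis pX pY jk ((Z a w).1, (Z b w).2) *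
        prodBasis pX pY jk ((Z c w).1, (Z d w).2)) 2 P ∧
      ∫ w, (∑ jk ∈ M, prodBasis pX pY jk ((Z a w).1, (Z b w).2) *
        prodBasis pX pY jk ((Z c w).1, (Z d w).2)) ^ 2 ∂P ≤ A ^ 4 * M.card := by
  classical
  have hmU := h.measurable_pair a b
  have hmV := h.measurable_pair c d
  have hind : IndepFun (fun w => ((Z a w).1, (Z b w).2)) (fun w => ((Z c w).1, (Z d w).2)) P := by
    have hdis : Disjoint ({a, b} : Finset (Fin n)) {c, d} := by
      simp [Finset.disjoint_left, hac, had, hbc, hbd]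
    refine (h.indep.indepFun_finset _ _ hdis h.measurable).comp
      (φ := fun w : (({a, b} : Finset (Fin n)) → 𝒳 × 𝒴) =>
        ((w ⟨a, by simp⟩).1, (w ⟨b, by simp⟩).2))
      (ψ := fun w : (({c, d} : Finset (Fin n)) → 𝒳 × 𝒴) =>
        ((w ⟨c, by simp⟩).1, (w ⟨d, by simp⟩).2)) ?_ ?_ <;> fun_prop
  have hGm : Measurable fun q : (𝒳 × 𝒴) × (𝒳 × 𝒴) =>
      ∑ jk ∈ M, prodBasis pX pY jk q.1 * prodBasis pX pY jk q.2 :=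
    Finset.measurable_fun_sum _ fun jk _ =>
      ((measurable_prodBasis hX hY jk).comp measurable_fst).mul
        ((measurable_prodBasis hX hY jk).comp measurable_snd)
  refine memLp_two_and_integral_sq_le
    (hGm.comp (hmU.prodMk hmV)).aestronglyMeasurable (by positivity) ?_
  have hG2 := (hGm.pow_const 2).ennreal_ofReal
  have h0 : ∫⁻ w, ENNReal.ofReal ((∑ jk ∈ M, prodBasis pX pY jk ((Z a w).1, (Z b w).2) *
        prodBasis pX pY jk ((Z c w).1, (Z d w).2)) ^ 2) ∂P =
      ∫⁻ u, ∫⁻ v, ENNReal.ofReal ((∑ jk ∈ M, prodBasis pX pY jk u * prodBasis pX pY jk v) ^ 2)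
        ∂(P.map fun w => ((Z c w).1, (Z d w).2)) ∂(P.map fun w => ((Z a w).1, (Z b w).2)) := by
    have : IsProbabilityMeasure (P.map fun w => ((Z c w).1, (Z d w).2)) :=
      Measure.isProbabilityMeasure_map hmV.aemeasurable
    rw [← lintegral_prod _ hG2.aemeasurable,
      ← (indepFun_iff_map_prod_eq_prod_map_map hmU.aemeasurable hmV.aemeasurable).1 hind,
      lintegral_map hG2 (hmU.prodMk hmV)]
  have h1 : ∀ u, ∫⁻ v, ENNReal.ofReal
      ((∑ jk ∈ M, prodBasis pX pY jk u * prodBasis pX pY jk v) ^ 2)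
        ∂(P.map fun w => ((Z c w).1, (Z d w).2)) ≤
      ENNReal.ofReal (A ^ 2) * ENNReal.ofReal (∑ jk ∈ M, prodBasis pX pY jk u ^ 2) := by
    intro u
    rw [lintegral_map ((measurable_linear hX hY M _).pow_const 2).ennreal_ofReal hmV,
      ← lintegral_sum_prodBasis_sq hX hY]
    exact h.lintegral_pair_le hA c d ((measurable_linear hX hY M _).pow_const 2).ennreal_ofReal
  have hSm : Measurable fun u => ENNReal.ofReal (∑ jk ∈ M, prodBasis pX pY jk u ^ 2) :=
    (Finset.measurable_fun_sum _ fun jk _ =>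
      (measurable_prodBasis hX hY jk).pow_const 2).ennreal_ofReal
  have h2 : ∫⁻ u, ENNReal.ofReal (∑ jk ∈ M, prodBasis pX pY jk u ^ 2) ∂(μX.prod μY) = M.card := by
    have h3 : ∀ jk : J × K, ∫⁻ u, ENNReal.ofReal (prodBasis pX pY jk u ^ 2) ∂(μX.prod μY) = 1 := by
      intro jk
      have := lintegral_sum_prodBasis_sq hX hY {jk} (fun _ => 1)
      simpa using this
    simp_rw [ENNReal.ofReal_sum_of_nonneg fun _ _ => sq_nonneg _]
    rw [lintegral_finsetSum _ fun jk _ =>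
      ((measurable_prodBasis hX hY jk).pow_const 2).ennreal_ofReal]
    simp [h3]
  rw [h0]
  refine (lintegral_mono h1).trans ?_
  rw [lintegral_const_mul _ hSm, lintegral_map hSm hmU]
  refine (mul_le_mul_right (h.lintegral_pair_le hA a b hSm) _).trans (le_of_eq ?_)
  rw [h2, ← mul_assoc, ← ENNReal.ofReal_mul (sq_nonneg A), ENNReal.ofReal_mul (p := A ^ 4) (by positivity),
    ENNReal.ofReal_natCast]
  congr 2
  ring

/-- Second moments of the bilinear sums `∑ p_{jk}(X_a, Y_b) p_{jk}(X_c, Y_d)`. -/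
theorem quadratic_moment (h : IsDominatedSample P μX μY A Z) (hA : 1 ≤ A)
    (hX : IsONBasisL2 μX pX) (hY : IsONBasisL2 μY pY) (M : Finset (J × K))
    {a b c d : Fin n} (hac : a ≠ c) (hbd : b ≠ d) :
    MemLp (fun w => ∑ jk ∈ M, prodBasis pX pY jk ((Z a w).1, (Z b w).2) *
        prodBasis pX pY jk ((Z c w).1, (Z d w).2)) 2 P ∧
      ∫ w, (∑ jk ∈ M, prodBasis pX pY jk ((Z a w).1, (Z b w).2) *
        prodBasis pX pY jk ((Z c w).1, (Z d w).2)) ^ 2 ∂P ≤ A ^ 4 * M.card := by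
  by_cases hcross : a ≠ d ∧ b ≠ c
  · exact h.quadratic_moment_of_disjoint hA hX hY M hac hcross.1 hcross.2 hbd
  -- If the pairs share an observation across coordinates (a = d or b = c), the product structure
  -- allows the Y-indices to be exchanged, and the exchanged pairs (a, d) and (c, b) are disjoint.
  · have hswap : ∀ (jk : J × K) (w : Ω), prodBasis pX pY jk ((Z a w).1, (Z b w).2) *
        prodBasis pX pY jk ((Z c w).1, (Z d w).2) =
        prodBasis pX pY jk ((Z a w).1, (Z d w).2) *
        prodBasis pX pY jk ((Z c w).1, (Z b w).2) := by
      intro jk w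
      simp only [prodBasis]
      ring
    simp_rw [hswap]
    have hab : a ≠ b := by
      rintro rfl
      exact hcross ⟨hbd, hac⟩
    have hdc : d ≠ c := by
      rintro rfl
      exact hcross ⟨hac, hbd⟩
    exact h.quadratic_moment_of_disjoint hA hX hY M hac hab hdc hbd.symm

end IsDominatedSample

end Sample

/-! ### The U-statistic as an average of products of covariance kernels. -/

section Algebra

variable {𝒳 𝒴 J K : Type*} {pX : J → 𝒳 → ℝ} {pY : K → 𝒴 → ℝ}

/-- The unbiased order-two kernel of the covariance of `p_j(X)` and `p_k(Y)`. -/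
def covKernel (pX : J → 𝒳 → ℝ) (pY : K → 𝒴 → ℝ) (jk : J × K) (z w : 𝒳 × 𝒴) : ℝ :=
  (pX jk.1 z.1 - pX jk.1 w.1) * (pY jk.2 z.2 - pY jk.2 w.2) / 2

/-- The sum over `M` of products of two covariance kernels. -/
def covQuad (pX : J → 𝒳 → ℝ) (pY : K → 𝒴 → ℝ) (M : Finset (J × K)) (z₁ z₂ z₃ z₄ : 𝒳 × 𝒴) : ℝ :=
  ∑ jk ∈ M, covKernel pX pY jk z₁ z₂ * covKernel pX pY jk z₃ z₄

theorem sum_embedding_reindex {n : ℕ} (τ : Equiv.Perm (Fin 4)) (φ : (Fin 4 → Fin n) → ℝ) :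
    ∑ I : Fin 4 ↪ Fin n, φ (fun s => I (τ s)) = ∑ I : Fin 4 ↪ Fin n, φ I :=
  Equiv.sum_comp (Equiv.embeddingCongr τ.symm (Equiv.refl (Fin n))) fun I => φ I

/-- Summing over all ordered quadruples of distinct indices, monomials that differ by a relabelling
of the four positions have equal sums, so only the symmetrisation of the kernel matters. -/
theorem sum_embedding_cov_product {n : ℕ} (u v : Fin n → ℝ) :
    ∑ I : Fin 4 ↪ Fin n, (u (I 0) * v (I 0) * (u (I 1) * v (I 1))
        - 2 * (u (I 0) * v (I 0) * (u (I 1) * v (I 2))) + u (I 0) * v (I 1) * (u (I 2) * v (I 3))) =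
      ∑ I : Fin 4 ↪ Fin n, ((u (I 0) - u (I 1)) * (v (I 0) - v (I 1)) / 2) *
        ((u (I 2) - u (I 3)) * (v (I 2) - v (I 3)) / 2) := by
  -- `e1` and `e2` replace each symmetric factor by its half u₀v₀ - u₀v₁ (positions 2, 3 for the
  -- second factor); `e3`, `e4`, `e5` relabel three of the four monomials of the expanded product.
  -- The two mixed ones have equal sums, whence the coefficient -2.
  have e1 := sum_embedding_reindex (n := n) (Equiv.swap 0 1) fun I =>
    (u (I 0) * v (I 0) - u (I 0) * v (I 1)) * ((u (I 2) - u (I 3)) * (v (I 2) - v (I 3)))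
  have e2 := sum_embedding_reindex (n := n) (Equiv.swap 2 3) fun I =>
    (u (I 0) * v (I 0) - u (I 0) * v (I 1)) * (u (I 2) * v (I 2) - u (I 2) * v (I 3))
  have e3 := sum_embedding_reindex (n := n) (Equiv.swap 1 2) fun I =>
    u (I 0) * v (I 0) * (u (I 1) * v (I 1))
  have e4 := sum_embedding_reindex (n := n) (Equiv.swap 1 2 * Equiv.swap 2 3) fun I =>
    u (I 0) * v (I 0) * (u (I 1) * v (I 2))
  have e5 := sum_embedding_reindex (n := n) (Equiv.swap 0 2 * Equiv.swap 1 2) fun I =>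
    u (I 0) * v (I 0) * (u (I 1) * v (I 2))
  have s01 : (Equiv.swap 0 1 : Equiv.Perm (Fin 4)) 0 = 1 ∧ (Equiv.swap 0 1 : Equiv.Perm (Fin 4)) 1 = 0
    ∧ (Equiv.swap 0 1 : Equiv.Perm (Fin 4)) 2 = 2 ∧ (Equiv.swap 0 1 : Equiv.Perm (Fin 4)) 3 = 3 := by
    decide
  have s23 : (Equiv.swap 2 3 : Equiv.Perm (Fin 4)) 0 = 0 ∧ (Equiv.swap 2 3 : Equiv.Perm (Fin 4)) 1 = 1
    ∧ (Equiv.swap 2 3 : Equiv.Perm (Fin 4)) 2 = 3 ∧ (Equiv.swap 2 3 : Equiv.Perm (Fin 4)) 3 = 2 := by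
    decide
  have s12 : (Equiv.swap 1 2 : Equiv.Perm (Fin 4)) 0 = 0 ∧ (Equiv.swap 1 2 : Equiv.Perm (Fin 4)) 1 = 2
    ∧ (Equiv.swap 1 2 : Equiv.Perm (Fin 4)) 2 = 1 ∧ (Equiv.swap 1 2 : Equiv.Perm (Fin 4)) 3 = 3 := by
    decide
  have s02 : (Equiv.swap 0 2 : Equiv.Perm (Fin 4)) 0 = 2 ∧ (Equiv.swap 0 2 : Equiv.Perm (Fin 4)) 1 = 1
    ∧ (Equiv.swap 0 2 : Equiv.Perm (Fin 4)) 2 = 0 := by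
    decide
  simp only [Equiv.Perm.mul_apply, s01, s23, s12, s02] at e1 e2 e3 e4 e5
  have h1 : ∑ I : Fin 4 ↪ Fin n, ((u (I 0) - u (I 1)) * (v (I 0) - v (I 1)) / 2) *
        ((u (I 2) - u (I 3)) * (v (I 2) - v (I 3)) / 2) =
      (∑ I : Fin 4 ↪ Fin n, (u (I 0) * v (I 0) - u (I 0) * v (I 1)) *
        ((u (I 2) - u (I 3)) * (v (I 2) - v (I 3)))) / 2 := by
    rw [eq_div_iff two_ne_zero, mul_two, ← mul_right_inj' two_ne_zero]
    conv_rhs => rw [two_mul]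
    conv_rhs => lhs; rw [← e1]
    rw [← Finset.sum_add_distrib, ← Finset.sum_add_distrib, Finset.mul_sum]
    refine Finset.sum_congr rfl fun I _ => ?_
    ring
  have h2 : ∑ I : Fin 4 ↪ Fin n, (u (I 0) * v (I 0) - u (I 0) * v (I 1)) *
        ((u (I 2) - u (I 3)) * (v (I 2) - v (I 3))) =
      2 * ∑ I : Fin 4 ↪ Fin n, (u (I 0) * v (I 0) - u (I 0) * v (I 1)) *
        (u (I 2) * v (I 2) - u (I 2) * v (I 3)) := by
    rw [two_mul]
    conv_rhs => lhs; rw [← e2]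
    rw [← Finset.sum_add_distrib]
    refine Finset.sum_congr rfl fun I _ => ?_
    ring
  rw [h1, h2, mul_div_cancel_left₀ _ two_ne_zero]
  simp only [sub_mul, mul_sub, Finset.sum_add_distrib, Finset.sum_sub_distrib, ← Finset.mul_sum]
  rw [e3, e4, ← e5]
  have h3 : ∀ I : Fin 4 ↪ Fin n, u (I 0) * v (I 1) * (u (I 2) * v (I 2)) =
      u (I 2) * v (I 2) * (u (I 0) * v (I 1)) := fun I => mul_comm _ _
  simp only [h3]
  ring

/-- This form shows both structures used later: for distinct independent observations each factor
has mean c, and exchanging the two Y-values in one factor changes its sign. -/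
theorem Dhat_eq_sum_covQuad (pX : J → 𝒳 → ℝ) (pY : K → 𝒴 → ℝ) (M : Finset (J × K)) {n : ℕ}
    (z : Fin n → 𝒳 × 𝒴) :
    Dhat pX pY M z = (Fintype.card (Fin 4 ↪ Fin n) : ℝ)⁻¹ *
      ∑ I : Fin 4 ↪ Fin n, covQuad pX pY M (z (I 0)) (z (I 1)) (z (I 2)) (z (I 3)) := by
  have hN : (Fintype.card (Fin 4 ↪ Fin n) : ℝ) = (Nat.factorial 4 : ℝ) * (n.choose 4 : ℝ) := by
    rw [Fintype.card_embedding_eq]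
    simp only [Fintype.card_fin, Nat.descFactorial_eq_factorial_mul_choose]
    push_cast
    rfl
  rw [Dhat, hN, one_div]
  congr 1
  simp only [kernel, covQuad, prodBasis, covKernel]
  rw [Finset.sum_comm]
  conv_rhs => rw [Finset.sum_comm]
  exact Finset.sum_congr rfl fun jk _ =>
    sum_embedding_cov_product (fun i => pX jk.1 (z i).1) fun i => pY jk.2 (z i).2

end Algebra

/-! ### Counting index quadruples that overlap a given one. -/

section Counting

/-- Such an embedding is determined by its values outside `S`. -/
theorem card_embedding_agree_le {n : ℕ} (S : Finset (Fin 4)) (q : Fin 4 → Fin n) :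
    (Finset.univ.filter fun I : Fin 4 ↪ Fin n => ∀ s ∈ S, I s = q s).card ≤ n ^ (Sᶜ).card := by
  have h : (Finset.univ : Finset ((Sᶜ : Finset (Fin 4)) → Fin n)).card = n ^ (Sᶜ).card := by
    rw [Finset.card_univ, Fintype.card_fun, Fintype.card_coe, Fintype.card_fin]
  rw [← h]
  refine Finset.card_le_card_of_injOn (fun I s => I s) (fun _ _ => Finset.mem_coe.2 (Finset.mem_univ _)) ?_
  intro I hI I' hI' hII
  simp only [Finset.coe_filter, Finset.mem_univ, true_and, Set.mem_ofPred_eq] at hI hI'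
  ext s
  by_cases hs : s ∈ S
  · rw [hI s hs, hI' s hs]
  · exact congrArg Fin.val (congrFun hII ⟨s, by simpa using hs⟩)

/-- The ranges of the two index quadruples meet. -/
def Meets {n : ℕ} (I I' : Fin 4 ↪ Fin n) : Prop := ∃ s t, I s = I' t

/-- Both halves of `I` meet the range of `I'`. -/
def MeetsTwice {n : ℕ} (I I' : Fin 4 ↪ Fin n) : Prop :=
  (∃ t, I 0 = I' t ∨ I 1 = I' t) ∧ ∃ t, I 2 = I' t ∨ I 3 = I' t

-- A union over the 16 position pairs (s, t) with I s = I' t; each fixes one value of I.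
open Classical in
theorem card_meets_le {n : ℕ} (I' : Fin 4 ↪ Fin n) :
    (Finset.univ.filter fun I => Meets I I').card ≤ 16 * n ^ 3 := by
  have hsub : (Finset.univ.filter fun I => Meets I I') ⊆
      (Finset.univ : Finset (Fin 4 × Fin 4)).biUnion fun st =>
        Finset.univ.filter fun I : Fin 4 ↪ Fin n => ∀ s ∈ ({st.1} : Finset (Fin 4)),
          I s = I' st.2 := by
    intro I hI
    obtain ⟨s, t, hst⟩ := (Finset.mem_filter.1 hI).2
    simp only [Finset.mem_biUnion, Finset.mem_filter, Finset.mem_univ, true_and]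
    exact ⟨(s, t), by simpa using hst⟩
  refine (Finset.card_le_card hsub).trans ?_
  refine (Finset.card_biUnion_le_card_mul _ _ (n ^ 3) fun st _ => ?_).trans (by simp)
  refine (card_embedding_agree_le {st.1} fun _ => I' st.2).trans (le_of_eq ?_)
  rw [Finset.card_compl]
  simp

-- Meeting I' in both halves fixes two values of I at distinct positions; 256 = 4⁴ bounds the
-- choices of the two positions in I and the two in I'.
open Classical in
theorem card_meetsTwice_le {n : ℕ} (I' : Fin 4 ↪ Fin n) :
    (Finset.univ.filter fun I => MeetsTwice I I').card ≤ 256 * n ^ 2 := by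
  have hsub : (Finset.univ.filter fun I => MeetsTwice I I') ⊆
      ((Finset.univ : Finset ((Fin 4 × Fin 4) × Fin 4 × Fin 4)).filter
        fun q => q.1.1 ≠ q.1.2).biUnion fun q =>
        Finset.univ.filter fun I : Fin 4 ↪ Fin n => ∀ s ∈ ({q.1.1, q.1.2} : Finset (Fin 4)),
          I s = if s = q.1.1 then I' q.2.1 else I' q.2.2 := by
    intro I hI
    have key : ∀ s s' t t', s ≠ s' → I s = I' t → I s' = I' t' →
        I ∈ ((Finset.univ : Finset ((Fin 4 × Fin 4) × Fin 4 × Fin 4)).filter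
        fun q => q.1.1 ≠ q.1.2).biUnion fun q =>
        Finset.univ.filter fun I : Fin 4 ↪ Fin n => ∀ s ∈ ({q.1.1, q.1.2} : Finset (Fin 4)),
          I s = if s = q.1.1 then I' q.2.1 else I' q.2.2 := by
      intro s s' t t' hne h h'
      simp only [Finset.mem_biUnion, Finset.mem_filter, Finset.mem_univ, true_and]
      refine ⟨((s, s'), t, t'), hne, ?_⟩
      intro a ha
      rcases Finset.mem_insert.1 ha with rfl | ha
      · simpa using h
      · rw [Finset.mem_singleton] at ha
        subst ha
        simpa [hne.symm] using h'
    obtain ⟨⟨t, ht⟩, ⟨t', ht'⟩⟩ := (Finset.mem_filter.1 hI).2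
    rcases ht with ht | ht <;> rcases ht' with ht' | ht' <;>
      exact key _ _ t t' (by decide) ht ht'
  refine (Finset.card_le_card hsub).trans ?_
  refine (Finset.card_biUnion_le_card_mul _ _ (n ^ 2) fun q hq => ?_).trans ?_
  · refine (card_embedding_agree_le _ _).trans (le_of_eq ?_)
    rw [Finset.card_compl, Finset.card_pair (Finset.mem_filter.1 hq).2]
    simp
  · refine Nat.mul_le_mul_right _ ((Finset.card_filter_le _ _).trans ?_)
    simp

theorem pow_four_le_card_embedding {n : ℕ} (hn : 6 ≤ n) :
    (n : ℝ) ^ 4 ≤ 8 * Fintype.card (Fin 4 ↪ Fin n) := by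
  rw [Fintype.card_embedding_eq]
  -- With n = m + 6 the truncated subtractions disappear, and the two sides can be compared
  -- coefficient by coefficient as polynomials in m ≥ 0.
  obtain ⟨m, rfl⟩ := Nat.exists_eq_add_of_le' hn
  simp only [Fintype.card_fin, Nat.descFactorial_succ, Nat.descFactorial_zero]
  have h1 : m + 6 - 3 = m + 3 := by omega
  have h2 : m + 6 - 2 = m + 4 := by omega
  have h3 : m + 6 - 1 = m + 5 := by omega
  rw [h1, h2, h3]
  push_cast
  have : (0 : ℝ) ≤ m := Nat.cast_nonneg m
  nlinarith [pow_nonneg this 2, pow_nonneg this 3, pow_nonneg this 4]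

end Counting

/-! ### Second moments of sums with few non-vanishing cross terms. -/

section Moments

variable {Ω : Type*} [MeasurableSpace Ω] {P : Measure Ω}

open Classical in
/-- Second moment of sums whose cross terms vanish, on average over `σ`, outside a relation. -/
theorem sum_integral_sum_sq_le {σ ι : Type*} [Fintype σ] [Fintype ι] (S : σ → ι → Ω → ℝ)
    (good : ι → ι → Prop) {V : ℝ} {k : ℕ} (hL : ∀ s I, MemLp (S s I) 2 P)
    (hV : ∀ s I, ∫ w, S s I w ^ 2 ∂P ≤ V) (hV0 : 0 ≤ V)
    (h0 : ∀ I I', ¬ good I I' → ∑ s, ∫ w, S s I w * S s I' w ∂P = 0)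
    (hk : ∀ I', (Finset.univ.filter fun I => good I I').card ≤ k) :
    ∑ s, ∫ w, (∑ I, S s I w) ^ 2 ∂P ≤ Fintype.card σ * (Fintype.card ι * (k * V)) := by
  have hi : ∀ s I I', Integrable (fun w => S s I w * S s I' w) P := fun s I I' =>
    (hL s I).integrable_mul (hL s I')
  have hexp : ∀ s, ∫ w, (∑ I, S s I w) ^ 2 ∂P = ∑ I', ∑ I, ∫ w, S s I w * S s I' w ∂P := by
    intro s
    simp_rw [sq, Finset.sum_mul_sum]
    rw [integral_finsetSum _ fun I _ => integrable_finsetSum _ fun I' _ => hi s I I',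
      Finset.sum_comm' (t' := Finset.univ) (s' := fun _ => Finset.univ) (by simp)]
    refine Finset.sum_congr rfl fun I _ => ?_
    rw [integral_finsetSum _ fun I' _ => hi s I I']
  -- The remaining cross terms are bounded by ab ≤ (a² + b²)/2; their number is controlled by `hk`.
  have hpair : ∀ s I I', ∫ w, S s I w * S s I' w ∂P ≤ V := by
    intro s I I'
    have h1 : ∫ w, S s I w * S s I' w ∂P ≤ ∫ w, (S s I w ^ 2 / 2 + S s I' w ^ 2 / 2) ∂P := by
      refine integral_mono (hi s I I')
        (((hL s I).integrable_sq.div_const 2).add ((hL s I').integrable_sq.div_const 2)) ?_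
      intro w
      have := sq_nonneg (S s I w - S s I' w)
      simp only
      nlinarith
    rw [integral_add ((hL s I).integrable_sq.div_const 2) ((hL s I').integrable_sq.div_const 2),
      integral_div, integral_div] at h1
    linarith [hV s I, hV s I']
  simp_rw [hexp]
  rw [Finset.sum_comm]
  calc ∑ I', ∑ s, ∑ I, ∫ w, S s I w * S s I' w ∂P
      = ∑ I', ∑ I, ∑ s, ∫ w, S s I w * S s I' w ∂P :=
        Finset.sum_congr rfl fun I' _ => Finset.sum_comm
    _ ≤ ∑ I' : ι, ∑ I, if good I I' then Fintype.card σ * V else 0 := by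
        refine Finset.sum_le_sum fun I' _ => Finset.sum_le_sum fun I _ => ?_
        split_ifs with hg
        · refine (Finset.sum_le_sum fun s _ => hpair s I I').trans (le_of_eq ?_)
          simp
        · exact (h0 I I' hg).le
    _ ≤ ∑ _I' : ι, k * (Fintype.card σ * V) := by
        refine Finset.sum_le_sum fun I' _ => ?_
        rw [← Finset.sum_filter, Finset.sum_const, nsmul_eq_mul]
        exact mul_le_mul_of_nonneg_right (by exact_mod_cast hk I') (by positivity)
    _ = Fintype.card σ * (Fintype.card ι * (k * V)) := by
        simp only [Finset.sum_const, Finset.card_univ, nsmul_eq_mul]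
        ring

theorem integral_sum_sq_le {ι : Type*} [Fintype ι] (S : ι → Ω → ℝ) {V : ℝ}
    (hL : ∀ I, MemLp (S I) 2 P) (hV : ∀ I, ∫ w, S I w ^ 2 ∂P ≤ V) (hV0 : 0 ≤ V) :
    ∫ w, (∑ I, S I w) ^ 2 ∂P ≤ (Fintype.card ι : ℝ) ^ 2 * V := by
  classical
  have h := sum_integral_sum_sq_le (σ := Unit) (fun _ => S) (fun _ _ => True)
    (k := Fintype.card ι) (fun _ => hL) (fun _ => hV) hV0 (by simp)
    (fun _ => by simp)
  simpa [sq, mul_assoc] using h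

end Moments

/-! ### The statistic of a randomly permuted sample. -/

section PermutedMoments

variable {Ω 𝒳 𝒴 J K : Type*} [MeasurableSpace Ω] [MeasurableSpace 𝒳] [MeasurableSpace 𝒴]
  {P : Measure Ω} [IsProbabilityMeasure P]
  {μX : Measure 𝒳} {μY : Measure 𝒴} [SigmaFinite μX] [SigmaFinite μY]
  {pX : J → 𝒳 → ℝ} {pY : K → 𝒴 → ℝ} {A : ℝ} {n : ℕ} {Z : Fin n → Ω → 𝒳 × 𝒴}

/-- Separating the X-indices from the Y-indices lets the moment bounds for pairs (X_a, Y_b) apply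
term by term, also after a permutation of the Y-values. -/
theorem covKernel_eq_sum (pX : J → 𝒳 → ℝ) (pY : K → 𝒴 → ℝ) (jk : J × K) (x : Fin 2 → 𝒳)
    (y : Fin 2 → 𝒴) :
    covKernel pX pY jk (x 0, y 0) (x 1, y 1) =
      ∑ q : Fin 2 × Fin 2, (-1) ^ (q.1.val + q.2.val) / 2 * prodBasis pX pY jk (x q.1, y q.2) := by
  simp only [Fintype.sum_prod_type, Fin.sum_univ_two, covKernel, prodBasis, Fin.val_zero,
    Fin.val_one]
  ring

namespace IsDominatedSample

theorem covLinear_moment (h : IsDominatedSample P μX μY A Z) (hA : 1 ≤ A)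
    (hX : IsONBasisL2 μX pX) (hY : IsONBasisL2 μY pY) (M : Finset (J × K)) (c : J × K → ℝ)
    (i j : Fin n) :
    MemLp (fun w => ∑ jk ∈ M, c jk * covKernel pX pY jk (Z i w) (Z j w)) 2 P ∧
      ∫ w, (∑ jk ∈ M, c jk * covKernel pX pY jk (Z i w) (Z j w)) ^ 2 ∂P ≤
        4 * A ^ 2 * ∑ jk ∈ M, c jk ^ 2 := by
  set ε : Fin 2 × Fin 2 → ℝ := fun q => (-1) ^ (q.1.val + q.2.val) / 2 with hε
  set S : Fin 2 × Fin 2 → Ω → ℝ := fun q w => ε q *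
    ∑ jk ∈ M, c jk * prodBasis pX pY jk ((Z (![i, j] q.1) w).1, (Z (![i, j] q.2) w).2) with hS
  have heq : ∀ w, ∑ jk ∈ M, c jk * covKernel pX pY jk (Z i w) (Z j w) = ∑ q, S q w := by
    intro w
    have h1 : ∀ jk, covKernel pX pY jk (Z i w) (Z j w) =
        ∑ q : Fin 2 × Fin 2, ε q *
          prodBasis pX pY jk ((Z (![i, j] q.1) w).1, (Z (![i, j] q.2) w).2) := fun jk =>
      covKernel_eq_sum pX pY jk (fun s => (Z (![i, j] s) w).1) fun s => (Z (![i, j] s) w).2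
    simp only [h1, hS, Finset.mul_sum]
    rw [Finset.sum_comm]
    exact Finset.sum_congr rfl fun q _ => Finset.sum_congr rfl fun jk _ => by ring
  have hm := fun q : Fin 2 × Fin 2 => h.linear_moment hA hX hY M c (![i, j] q.1) (![i, j] q.2)
  have hL : ∀ q, MemLp (S q) 2 P := fun q => (hm q).1.const_mul _
  have hε2 : ∀ q, ε q ^ 2 = 1 / 4 := by
    intro q
    rcases neg_one_pow_eq_or ℝ (q.1.val + q.2.val) with h1 | h1 <;> simp only [hε, h1] <;> norm_num
  have hV : ∀ q, ∫ w, S q w ^ 2 ∂P ≤ A ^ 2 * (∑ jk ∈ M, c jk ^ 2) / 4 := by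
    intro q
    simp only [hS, mul_pow, hε2, integral_const_mul]
    linarith [(hm q).2]
  have hsum : 0 ≤ ∑ jk ∈ M, c jk ^ 2 := Finset.sum_nonneg fun _ _ => sq_nonneg _
  -- Four terms of squared weight 1/4 give the constant 4²/4 = 4.
  have h2 := integral_sum_sq_le S hL hV (by positivity)
  simp only [heq]
  refine ⟨memLp_finsetSum _ fun q _ => hL q, h2.trans (le_of_eq ?_)⟩
  simp only [Fintype.card_prod, Fintype.card_fin]
  push_cast
  ring

/-- Second moments of the kernel evaluated at a permuted sample. -/
theorem covQuad_moment (h : IsDominatedSample P μX μY A Z) (hA : 1 ≤ A)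
    (hX : IsONBasisL2 μX pX) (hY : IsONBasisL2 μY pY) (M : Finset (J × K))
    (σ : Equiv.Perm (Fin n)) (I : Fin 4 ↪ Fin n) :
    MemLp (fun w => covQuad pX pY M (permute σ (fun k => Z k w) (I 0))
      (permute σ (fun k => Z k w) (I 1)) (permute σ (fun k => Z k w) (I 2))
      (permute σ (fun k => Z k w) (I 3))) 2 P ∧
      ∫ w, covQuad pX pY M (permute σ (fun k => Z k w) (I 0))
      (permute σ (fun k => Z k w) (I 1)) (permute σ (fun k => Z k w) (I 2))
      (permute σ (fun k => Z k w) (I 3)) ^ 2 ∂P ≤ 16 * A ^ 4 * M.card := by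
  set ε : Fin 2 × Fin 2 → ℝ := fun q => (-1) ^ (q.1.val + q.2.val) / 2 with hε
  set a : Fin 2 → Fin n := ![I 0, I 1] with ha
  set b : Fin 2 → Fin n := ![I 2, I 3] with hb
  have hab : ∀ s t, a s ≠ b t := by
    intro s t
    fin_cases s <;> fin_cases t <;> simp [ha, hb]
  set Q : (Fin 2 × Fin 2) × (Fin 2 × Fin 2) → Ω → ℝ := fun q w =>
    ∑ jk ∈ M, prodBasis pX pY jk ((Z (a q.1.1) w).1, (Z (σ (a q.1.2)) w).2) *
      prodBasis pX pY jk ((Z (b q.2.1) w).1, (Z (σ (b q.2.2)) w).2) with hQ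
  set S : (Fin 2 × Fin 2) × (Fin 2 × Fin 2) → Ω → ℝ := fun q w => ε q.1 * ε q.2 * Q q w with hS
  have heq : ∀ w, covQuad pX pY M (permute σ (fun k => Z k w) (I 0))
      (permute σ (fun k => Z k w) (I 1)) (permute σ (fun k => Z k w) (I 2))
      (permute σ (fun k => Z k w) (I 3)) = ∑ q, S q w := by
    intro w
    have h1 : ∀ jk, covKernel pX pY jk (permute σ (fun k => Z k w) (I 0))
        (permute σ (fun k => Z k w) (I 1)) = ∑ q : Fin 2 × Fin 2, ε q *
          prodBasis pX pY jk ((Z (a q.1) w).1, (Z (σ (a q.2)) w).2) := fun jk =>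
      covKernel_eq_sum pX pY jk (fun s => (Z (a s) w).1) fun s => (Z (σ (a s)) w).2
    have h2 : ∀ jk, covKernel pX pY jk (permute σ (fun k => Z k w) (I 2))
        (permute σ (fun k => Z k w) (I 3)) = ∑ q : Fin 2 × Fin 2, ε q *
          prodBasis pX pY jk ((Z (b q.1) w).1, (Z (σ (b q.2)) w).2) := fun jk =>
      covKernel_eq_sum pX pY jk (fun s => (Z (b s) w).1) fun s => (Z (σ (b s)) w).2
    simp only [covQuad, h1, h2, hS, hQ, Finset.sum_mul_sum]
    simp only [Finset.mul_sum]
    rw [Fintype.sum_prod_type, Finset.sum_comm]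
    refine Finset.sum_congr rfl fun q _ => ?_
    rw [Finset.sum_comm]
    exact Finset.sum_congr rfl fun q' _ => Finset.sum_congr rfl fun jk _ => by ring
  have hm := fun q : (Fin 2 × Fin 2) × (Fin 2 × Fin 2) =>
    h.quadratic_moment hA hX hY M (a := a q.1.1) (b := σ (a q.1.2)) (c := b q.2.1)
      (d := σ (b q.2.2)) (hab _ _) (fun hh => hab _ _ (σ.injective hh))
  have hL : ∀ q, MemLp (S q) 2 P := fun q => (hm q).1.const_mul _
  have hε2 : ∀ q, ε q ^ 2 = 1 / 4 := by
    intro q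
    rcases neg_one_pow_eq_or ℝ (q.1.val + q.2.val) with h1 | h1 <;> simp only [hε, h1] <;> norm_num
  have hV : ∀ q, ∫ w, S q w ^ 2 ∂P ≤ A ^ 4 * M.card / 16 := by
    intro q
    simp only [hS, mul_pow, hε2, integral_const_mul]
    linarith [(hm q).2]
  -- Sixteen terms of squared weight 1/16 give the constant 16²/16 = 16.
  have h2 := integral_sum_sq_le S hL hV (by positivity)
  simp only [heq]
  refine ⟨memLp_finsetSum _ fun q _ => hL q, h2.trans (le_of_eq ?_)⟩
  simp only [Fintype.card_prod, Fintype.card_fin]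
  push_cast
  ring

end IsDominatedSample

/-- Swapping the two values of a permutation at the indices of the first or second covariance
kernel changes the sign of the kernel, so that cross terms cancel in the sum over permutations. -/
theorem sum_perm_covQuad_mul_eq_zero (pX : J → 𝒳 → ℝ) (pY : K → 𝒴 → ℝ) (M : Finset (J × K))
    (z : Fin n → 𝒳 × 𝒴) {I I' : Fin 4 ↪ Fin n} (hI : ¬ MeetsTwice I I') :
    ∑ σ : Equiv.Perm (Fin n),
      covQuad pX pY M (permute σ z (I 0)) (permute σ z (I 1)) (permute σ z (I 2))
        (permute σ z (I 3)) *
      covQuad pX pY M (permute σ z (I' 0)) (permute σ z (I' 1)) (permute σ z (I' 2))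
        (permute σ z (I' 3)) = 0 := by
  set F : Equiv.Perm (Fin n) → ℝ := fun σ =>
      covQuad pX pY M (permute σ z (I 0)) (permute σ z (I 1)) (permute σ z (I 2))
        (permute σ z (I 3)) *
      covQuad pX pY M (permute σ z (I' 0)) (permute σ z (I' 1)) (permute σ z (I' 2))
        (permute σ z (I' 3)) with hF
  have key : ∀ τ : Equiv.Perm (Fin n), (∀ σ, F (σ * τ) = - F σ) → ∑ σ, F σ = 0 := by
    intro τ hτ
    have h1 := Equiv.sum_comp (Equiv.mulRight τ) F
    simp only [Equiv.coe_mulRight, hτ, Finset.sum_neg_distrib] at h1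
    linarith
  have hperm : ∀ (σ τ : Equiv.Perm (Fin n)) (i : Fin n), τ i = i →
      permute (σ * τ) z i = permute σ z i := by
    intro σ τ i hi
    simp [permute, hi]
  have hflip : ∀ (σ : Equiv.Perm (Fin n)) (i j : Fin n) (jk : J × K),
      covKernel pX pY jk (permute (σ * Equiv.swap i j) z i) (permute (σ * Equiv.swap i j) z j) =
        - covKernel pX pY jk (permute σ z i) (permute σ z j) := by
    intro σ i j jk
    simp only [covKernel, permute, Equiv.Perm.mul_apply, Equiv.swap_apply_left,
      Equiv.swap_apply_right]
    ring
  have hne : ∀ s t, s ≠ t → I s ≠ I t := fun s t hst hh => hst (I.injective hh)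
  rw [MeetsTwice, not_and_or] at hI
  rcases hI with hI | hI <;> push Not at hI
  -- The exchange affects the permuted sample only at I 0 and I 1. The second factor of I and the
  -- whole of I' avoid these indices, so exactly one covariance kernel changes sign.
  · refine key (Equiv.swap (I 0) (I 1)) fun σ => ?_
    have h1 : ∀ t, permute (σ * Equiv.swap (I 0) (I 1)) z (I' t) = permute σ z (I' t) := fun t =>
      hperm _ _ _ (Equiv.swap_apply_of_ne_of_ne (hI t).1.symm (hI t).2.symm)
    have h2 : permute (σ * Equiv.swap (I 0) (I 1)) z (I 2) = permute σ z (I 2) :=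
      hperm _ _ _ (Equiv.swap_apply_of_ne_of_ne (hne _ _ (by decide)) (hne _ _ (by decide)))
    have h3 : permute (σ * Equiv.swap (I 0) (I 1)) z (I 3) = permute σ z (I 3) :=
      hperm _ _ _ (Equiv.swap_apply_of_ne_of_ne (hne _ _ (by decide)) (hne _ _ (by decide)))
    simp only [hF, h1, h2, h3]
    rw [← neg_mul]
    congr 1
    simp only [covQuad, hflip, neg_mul, Finset.sum_neg_distrib]
  · refine key (Equiv.swap (I 2) (I 3)) fun σ => ?_
    have h1 : ∀ t, permute (σ * Equiv.swap (I 2) (I 3)) z (I' t) = permute σ z (I' t) := fun t =>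
      hperm _ _ _ (Equiv.swap_apply_of_ne_of_ne (hI t).1.symm (hI t).2.symm)
    have h2 : permute (σ * Equiv.swap (I 2) (I 3)) z (I 0) = permute σ z (I 0) :=
      hperm _ _ _ (Equiv.swap_apply_of_ne_of_ne (hne _ _ (by decide)) (hne _ _ (by decide)))
    have h3 : permute (σ * Equiv.swap (I 2) (I 3)) z (I 1) = permute σ z (I 1) :=
      hperm _ _ _ (Equiv.swap_apply_of_ne_of_ne (hne _ _ (by decide)) (hne _ _ (by decide)))
    simp only [hF, h1, h2, h3]
    rw [← neg_mul]
    congr 1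
    simp only [covQuad, hflip, mul_neg, Finset.sum_neg_distrib]

namespace IsDominatedSample

theorem memLp_Dhat_permute (h : IsDominatedSample P μX μY A Z) (hA : 1 ≤ A)
    (hX : IsONBasisL2 μX pX) (hY : IsONBasisL2 μY pY) (M : Finset (J × K))
    (σ : Equiv.Perm (Fin n)) :
    MemLp (fun w => Dhat pX pY M (permute σ fun k => Z k w)) 2 P := by
  simp_rw [Dhat_eq_sum_covQuad]
  exact (memLp_finsetSum _ fun I _ => (h.covQuad_moment hA hX hY M σ I).1).const_mul _

/-- The second moment of the U-statistic of a randomly permuted sample. -/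
theorem sum_perm_integral_Dhat_sq_le (h : IsDominatedSample P μX μY A Z) (hA : 1 ≤ A)
    (hX : IsONBasisL2 μX pX) (hY : IsONBasisL2 μY pY) (M : Finset (J × K)) (hn : 6 ≤ n) :
    ∑ σ : Equiv.Perm (Fin n), ∫ w, Dhat pX pY M (permute σ fun k => Z k w) ^ 2 ∂P ≤
      Nat.factorial n * (2 ^ 15 * A ^ 4 * M.card / (n : ℝ) ^ 2) := by
  have hmain := sum_integral_sum_sq_le
    (fun (σ : Equiv.Perm (Fin n)) (I : Fin 4 ↪ Fin n) w =>
      covQuad pX pY M (permute σ (fun k => Z k w) (I 0))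
      (permute σ (fun k => Z k w) (I 1)) (permute σ (fun k => Z k w) (I 2))
      (permute σ (fun k => Z k w) (I 3))) MeetsTwice
    (fun σ I => (h.covQuad_moment hA hX hY M σ I).1)
    (fun σ I => (h.covQuad_moment hA hX hY M σ I).2) (by positivity)
    -- The cancellation takes place for every fixed data set, before integration, so it holds
    -- however dependent X and Y are.
    (fun I I' hI => by
      refine (integral_finsetSum _ fun σ _ => (h.covQuad_moment hA hX hY M σ I).1.integrable_mul
        (h.covQuad_moment hA hX hY M σ I').1).symm.trans ?_
      simp only [Pi.mul_apply, sum_perm_covQuad_mul_eq_zero pX pY M _ hI, integral_zero])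
    (fun I' => card_meetsTwice_le I')
  rw [Fintype.card_perm, Fintype.card_fin] at hmain
  simp_rw [Dhat_eq_sum_covQuad, mul_pow, integral_const_mul]
  rw [← Finset.mul_sum]
  have hN := pow_four_le_card_embedding hn
  set N : ℝ := (Fintype.card (Fin 4 ↪ Fin n) : ℝ)
  have hn0 : (0 : ℝ) < n := by
    have : 0 < n := by omega
    exact_mod_cast this
  have hNpos : 0 < N := by
    have := pow_pos hn0 4
    linarith
  refine (mul_le_mul_of_nonneg_left hmain (by positivity)).trans ?_
  -- 256 · 16 = 2¹², and the bound n⁴ ≤ 8N turns this into 2¹⁵.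
  have h1 : N⁻¹ ^ 2 * (Nat.factorial n * (N * ((256 * n ^ 2 : ℕ) * (16 * A ^ 4 * M.card)))) =
      Nat.factorial n * ((2 ^ 12 * A ^ 4 * M.card * n ^ 2) / N) := by
    field_simp
    push_cast
    ring
  rw [h1]
  refine mul_le_mul_of_nonneg_left ?_ (by positivity)
  rw [div_le_div_iff₀ hNpos (by positivity)]
  have h2 : 0 ≤ A ^ 4 * M.card := by positivity
  nlinarith [mul_le_mul_of_nonneg_left hN h2]

end IsDominatedSample

end PermutedMoments

/-! ### Mean squared error of the statistic on the original sample. -/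

section UnpermutedMoments

variable {Ω 𝒳 𝒴 J K : Type*} [MeasurableSpace Ω] [MeasurableSpace 𝒳] [MeasurableSpace 𝒴]
  {P : Measure Ω} [IsProbabilityMeasure P]
  {μX : Measure 𝒳} {μY : Measure 𝒴} [SigmaFinite μX] [SigmaFinite μY]
  {pX : J → 𝒳 → ℝ} {pY : K → 𝒴 → ℝ} {A : ℝ} {n : ℕ} {Z : Fin n → Ω → 𝒳 × 𝒴}
  {c : J × K → ℝ}

theorem measurable_covKernel (hX : IsONBasisL2 μX pX) (hY : IsONBasisL2 μY pY) (jk : J × K) :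
    Measurable fun q : (𝒳 × 𝒴) × (𝒳 × 𝒴) => covKernel pX pY jk q.1 q.2 := by
  have h1 := hX.1 jk.1
  have h2 := hY.1 jk.2
  unfold covKernel
  fun_prop

/-- The first-order part of the decomposition of the kernel. -/
def linearPart (pX : J → 𝒳 → ℝ) (pY : K → 𝒴 → ℝ) (c : J × K → ℝ) (M : Finset (J × K))
    (z w : 𝒳 × 𝒴) : ℝ :=
  ∑ jk ∈ M, c jk * covKernel pX pY jk z w - ∑ jk ∈ M, c jk ^ 2

/-- The doubly centred part of the decomposition of the kernel. -/
def centredPart (pX : J → 𝒳 → ℝ) (pY : K → 𝒴 → ℝ) (c : J × K → ℝ) (M : Finset (J × K))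
    (z₁ z₂ z₃ z₄ : 𝒳 × 𝒴) : ℝ :=
  ∑ jk ∈ M, (covKernel pX pY jk z₁ z₂ - c jk) * (covKernel pX pY jk z₃ z₄ - c jk)

/-- A Hoeffding-type splitting into the mean, linear terms weighted by c, and a product of two
centred kernels, so that the parts of order D_M/n and |M|/n² can be treated separately. -/
theorem covQuad_decomposition (pX : J → 𝒳 → ℝ) (pY : K → 𝒴 → ℝ) (c : J × K → ℝ)
    (M : Finset (J × K)) (z₁ z₂ z₃ z₄ : 𝒳 × 𝒴) :
    covQuad pX pY M z₁ z₂ z₃ z₄ = ∑ jk ∈ M, c jk ^ 2 +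
      ((linearPart pX pY c M z₁ z₂ + linearPart pX pY c M z₃ z₄) +
        centredPart pX pY c M z₁ z₂ z₃ z₄) := by
  simp only [covQuad, linearPart, centredPart]
  have h : ∀ a b d : ℝ, (a - d) * (b - d) = a * b - d * a - d * b + d ^ 2 := fun a b d => by ring
  simp only [h, Finset.sum_add_distrib, Finset.sum_sub_distrib]
  ring

theorem measurable_linearPart (hX : IsONBasisL2 μX pX) (hY : IsONBasisL2 μY pY)
    (M : Finset (J × K)) :
    Measurable fun q : (𝒳 × 𝒴) × (𝒳 × 𝒴) => linearPart pX pY c M q.1 q.2 :=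
  (Finset.measurable_fun_sum _ fun jk _ =>
    (measurable_covKernel hX hY jk).const_mul (c jk)).sub_const _

theorem measurable_centredPart (hX : IsONBasisL2 μX pX) (hY : IsONBasisL2 μY pY)
    (M : Finset (J × K)) :
    Measurable fun q : ((𝒳 × 𝒴) × (𝒳 × 𝒴)) × ((𝒳 × 𝒴) × (𝒳 × 𝒴)) =>
      centredPart pX pY c M q.1.1 q.1.2 q.2.1 q.2.2 :=
  Finset.measurable_fun_sum _ fun jk _ =>
    (((measurable_covKernel hX hY jk).comp measurable_fst).sub_const _).mul
      (((measurable_covKernel hX hY jk).comp measurable_snd).sub_const _)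

/-- The covariance kernels have mean `c`. -/
def HasCovMean (P : Measure Ω) (pX : J → 𝒳 → ℝ) (pY : K → 𝒴 → ℝ) (c : J × K → ℝ)
    (Z : Fin n → Ω → 𝒳 × 𝒴) : Prop :=
  ∀ jk i j, i ≠ j → ∫ w, covKernel pX pY jk (Z i w) (Z j w) ∂P = c jk

namespace IsDominatedSample

theorem memLp_covKernel (h : IsDominatedSample P μX μY A Z) (hA : 1 ≤ A)
    (hX : IsONBasisL2 μX pX) (hY : IsONBasisL2 μY pY) (jk : J × K) (i j : Fin n) :
    MemLp (fun w => covKernel pX pY jk (Z i w) (Z j w)) 2 P := by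
  simpa using (h.covLinear_moment hA hX hY {jk} (fun _ => 1) i j).1

theorem integral_covLinear (h : IsDominatedSample P μX μY A Z) (hA : 1 ≤ A)
    (hX : IsONBasisL2 μX pX) (hY : IsONBasisL2 μY pY) (M : Finset (J × K))
    (hc : HasCovMean P pX pY c Z) {i j : Fin n} (hij : i ≠ j) :
    ∫ w, ∑ jk ∈ M, c jk * covKernel pX pY jk (Z i w) (Z j w) ∂P = ∑ jk ∈ M, c jk ^ 2 := by
  rw [integral_finsetSum _ fun jk _ =>
    ((h.memLp_covKernel hA hX hY jk i j).integrable one_le_two).const_mul (c jk)]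
  refine Finset.sum_congr rfl fun jk _ => ?_
  rw [integral_const_mul, hc jk i j hij, sq]

/-- With D the sum in question, the linear form with coefficients c has mean D and second moment at
most 4A²D, so D² ≤ 4A²D. This lets D² be absorbed into A²D or A⁴. -/
theorem sum_sq_le (h : IsDominatedSample P μX μY A Z) (hA : 1 ≤ A)
    (hX : IsONBasisL2 μX pX) (hY : IsONBasisL2 μY pY) (M : Finset (J × K))
    (hc : HasCovMean P pX pY c Z) {i j : Fin n} (hij : i ≠ j) :
    ∑ jk ∈ M, c jk ^ 2 ≤ 4 * A ^ 2 := by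
  have hm := h.covLinear_moment hA hX hY M c i j
  have h1 := h.integral_covLinear hA hX hY M hc hij
  set W : Ω → ℝ := fun w => ∑ jk ∈ M, c jk * covKernel pX pY jk (Z i w) (Z j w)
  set D := ∑ jk ∈ M, c jk ^ 2
  have hD : 0 ≤ D := Finset.sum_nonneg fun _ _ => sq_nonneg _
  have h2 : 0 ≤ ∫ w, (W w - D) ^ 2 ∂P := integral_nonneg fun _ => sq_nonneg _
  have h3 : ∫ w, (W w - D) ^ 2 ∂P = ∫ w, W w ^ 2 ∂P - 2 * D * D + D ^ 2 := by
    have e : ∀ w, (W w - D) ^ 2 = W w ^ 2 - 2 * D * W w + D ^ 2 := fun w => by ring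
    simp_rw [e]
    have i1 : Integrable W P := hm.1.integrable one_le_two
    have i2 : Integrable (fun w => W w ^ 2 - 2 * D * W w) P :=
      hm.1.integrable_sq.sub (i1.const_mul _)
    rw [integral_add i2 (integrable_const _),
      integral_sub hm.1.integrable_sq (i1.const_mul _), integral_const_mul, h1]
    simp
  have h4 := hm.2
  rcases hD.eq_or_lt with h0 | h0
  · rw [← h0]
    positivity
  · nlinarith

/-- The variance bound is proportional to the sum of c² itself; this is what lets the first-order
error be compared with the signal. -/
theorem linearPart_moment (h : IsDominatedSample P μX μY A Z) (hA : 1 ≤ A)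
    (hX : IsONBasisL2 μX pX) (hY : IsONBasisL2 μY pY) (M : Finset (J × K))
    (hc : HasCovMean P pX pY c Z) {i j : Fin n} (hij : i ≠ j) :
    MemLp (fun w => linearPart pX pY c M (Z i w) (Z j w)) 2 P ∧
      ∫ w, linearPart pX pY c M (Z i w) (Z j w) ∂P = 0 ∧
      ∫ w, linearPart pX pY c M (Z i w) (Z j w) ^ 2 ∂P ≤ 16 * A ^ 2 * ∑ jk ∈ M, c jk ^ 2 := by
  have hm := h.covLinear_moment hA hX hY M c i j
  have h1 := h.integral_covLinear hA hX hY M hc hij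
  have hb := h.sum_sq_le hA hX hY M hc hij
  simp only [linearPart]
  set W : Ω → ℝ := fun w => ∑ jk ∈ M, c jk * covKernel pX pY jk (Z i w) (Z j w)
  set D := ∑ jk ∈ M, c jk ^ 2
  have hD : 0 ≤ D := Finset.sum_nonneg fun _ _ => sq_nonneg _
  have hL : MemLp (fun w => W w - D) 2 P := hm.1.sub (memLp_const D)
  refine ⟨hL, ?_, ?_⟩
  · change ∫ w, W w - D ∂P = 0
    rw [integral_sub (hm.1.integrable one_le_two) (integrable_const _), h1]
    simp
  · have h2 : ∫ w, (W w - D) ^ 2 ∂P ≤ ∫ w, (2 * W w ^ 2 + 2 * D ^ 2) ∂P := by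
      refine integral_mono hL.integrable_sq
        ((hm.1.integrable_sq.const_mul 2).add (integrable_const _)) fun w => ?_
      have := sq_nonneg (W w + D)
      simp only
      nlinarith
    rw [integral_add (hm.1.integrable_sq.const_mul 2) (integrable_const _), integral_const_mul] at h2
    simp only [integral_const, probReal_univ, one_smul] at h2
    have h4 := hm.2
    change ∫ w, (W w - D) ^ 2 ∂P ≤ _
    nlinarith [mul_le_mul_of_nonneg_right hb hD]

theorem centredPart_moment (h : IsDominatedSample P μX μY A Z) (hA : 1 ≤ A)
    (hX : IsONBasisL2 μX pX) (hY : IsONBasisL2 μY pY) {M : Finset (J × K)} (hM : M.Nonempty)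
    (hc : HasCovMean P pX pY c Z) (I : Fin 4 ↪ Fin n) :
    MemLp (fun w => centredPart pX pY c M (Z (I 0) w) (Z (I 1) w) (Z (I 2) w) (Z (I 3) w)) 2 P ∧
      ∫ w, centredPart pX pY c M (Z (I 0) w) (Z (I 1) w) (Z (I 2) w) (Z (I 3) w) ^ 2 ∂P ≤
        256 * A ^ 4 * M.card := by
  have h01 : I 0 ≠ I 1 := fun hh => absurd (I.injective hh) (by decide)
  obtain ⟨hT, hT2⟩ := h.covQuad_moment hA hX hY M 1 I
  obtain ⟨hW, hW2⟩ := h.covLinear_moment hA hX hY M c (I 0) (I 1)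
  obtain ⟨hV, hV2⟩ := h.covLinear_moment hA hX hY M c (I 2) (I 3)
  have hb := h.sum_sq_le hA hX hY M hc h01
  simp only [permute, Equiv.Perm.one_apply, Prod.mk.eta] at hT hT2
  set T : Ω → ℝ := fun w => covQuad pX pY M (Z (I 0) w) (Z (I 1) w) (Z (I 2) w) (Z (I 3) w)
  set W : Ω → ℝ := fun w => ∑ jk ∈ M, c jk * covKernel pX pY jk (Z (I 0) w) (Z (I 1) w)
  set V : Ω → ℝ := fun w => ∑ jk ∈ M, c jk * covKernel pX pY jk (Z (I 2) w) (Z (I 3) w)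
  set D := ∑ jk ∈ M, c jk ^ 2 with hDdef
  have hD : 0 ≤ D := Finset.sum_nonneg fun _ _ => sq_nonneg _
  have heq : ∀ w, centredPart pX pY c M (Z (I 0) w) (Z (I 1) w) (Z (I 2) w) (Z (I 3) w) =
      T w - W w - V w + D := by
    intro w
    have := covQuad_decomposition pX pY c M (Z (I 0) w) (Z (I 1) w) (Z (I 2) w) (Z (I 3) w)
    simp only [linearPart] at this
    simp only [T, W, V, D]
    linarith
  simp only [heq]
  have hQ : MemLp (fun w => T w - W w - V w + D) 2 P := ((hT.sub hW).sub hV).add (memLp_const D)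
  refine ⟨hQ, ?_⟩
  have i0 : Integrable (fun w => T w ^ 2 + W w ^ 2) P := hT.integrable_sq.add hW.integrable_sq
  have i1 : Integrable (fun w => T w ^ 2 + W w ^ 2 + V w ^ 2) P := i0.add hV.integrable_sq
  have h2 : ∫ w, (T w - W w - V w + D) ^ 2 ∂P ≤
      ∫ w, 4 * (T w ^ 2 + W w ^ 2 + V w ^ 2 + D ^ 2) ∂P := by
    refine integral_mono hQ.integrable_sq ((i1.add (integrable_const (D ^ 2))).const_mul 4)
      fun w => ?_
    simp only
    nlinarith [sq_nonneg (T w + W w), sq_nonneg (T w + V w), sq_nonneg (T w - D),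
      sq_nonneg (W w - V w), sq_nonneg (W w + D), sq_nonneg (V w + D)]
  have h3 : ∫ w, 4 * (T w ^ 2 + W w ^ 2 + V w ^ 2 + D ^ 2) ∂P =
      4 * (∫ w, T w ^ 2 ∂P + ∫ w, W w ^ 2 ∂P + ∫ w, V w ^ 2 ∂P + D ^ 2) := by
    rw [integral_const_mul, integral_add i1 (integrable_const _),
      integral_add i0 hV.integrable_sq,
      integral_add hT.integrable_sq hW.integrable_sq]
    simp
  rw [h3] at h2
  -- Nonemptiness of M absorbs the terms of order A⁴ into A⁴|M|; each of the four squares is then at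
  -- most 16A⁴|M|.
  have hm1 : (1 : ℝ) ≤ M.card := by exact_mod_cast hM.card_pos
  have hA4 : 0 ≤ A ^ 4 := by positivity
  have h5 : A ^ 4 ≤ A ^ 4 * M.card := le_mul_of_one_le_right hA4 hm1
  have h6 : A ^ 2 * D ≤ 4 * A ^ 4 := by nlinarith [mul_le_mul_of_nonneg_left hb (sq_nonneg A)]
  have h7 : D ^ 2 ≤ 16 * A ^ 4 := by nlinarith
  linarith

theorem measurable_eval_pair {ι : Type*} (i j : ι) :
    Measurable fun v : ι → 𝒳 × 𝒴 => (v i, v j) :=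
  (measurable_pi_apply i).prodMk (measurable_pi_apply j)

theorem integral_pair_mul_eq_zero (h : IsDominatedSample P μX μY A Z) {a b : Fin n}
    {T : Finset (Fin n)} (ha : a ∉ T) (hb : b ∉ T)
    {φ : (𝒳 × 𝒴) × (𝒳 × 𝒴) → ℝ} (hφ : Measurable φ)
    {ψ : (T → 𝒳 × 𝒴) → ℝ} (hψ : Measurable ψ)
    (h0 : ∫ w, φ (Z a w, Z b w) ∂P = 0) :
    ∫ w, φ (Z a w, Z b w) * ψ (fun i => Z i w) ∂P = 0 := by
  have hind : IndepFun (fun w => φ (Z a w, Z b w)) (fun w => ψ fun i => Z i w) P := by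
    refine (h.indep.indepFun_finset {a, b} T (by simp [ha, hb]) h.measurable).comp
      (φ := fun v : (({a, b} : Finset (Fin n)) → 𝒳 × 𝒴) =>
        φ (v ⟨a, by simp⟩, v ⟨b, by simp⟩)) (ψ := ψ) ?_ hψ
    exact hφ.comp ((measurable_pi_apply _).prodMk (measurable_pi_apply _))
  rw [hind.integral_fun_mul_eq_mul_integral
    (hφ.comp ((h.measurable a).prodMk (h.measurable b))).aestronglyMeasurable
    (hψ.comp (measurable_pi_lambda _ fun i => h.measurable i)).aestronglyMeasurable, h0, zero_mul]

theorem integral_centred_eq_zero (h : IsDominatedSample P μX μY A Z) (hA : 1 ≤ A)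
    (hX : IsONBasisL2 μX pX) (hY : IsONBasisL2 μY pY)
    (hc : HasCovMean P pX pY c Z) (jk : J × K) {i j : Fin n} (hij : i ≠ j) :
    ∫ w, (covKernel pX pY jk (Z i w) (Z j w) - c jk) ∂P = 0 := by
  rw [integral_sub ((h.memLp_covKernel hA hX hY jk i j).integrable one_le_two)
    (integrable_const _), hc jk i j hij]
  simp

/-- One half of I is disjoint from I' and from the other half. For each jk the centred kernel on
that half has mean zero and is independent of everything else in the product. -/
theorem integral_centredPart_mul_eq_zero (h : IsDominatedSample P μX μY A Z) (hA : 1 ≤ A)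
    (hX : IsONBasisL2 μX pX) (hY : IsONBasisL2 μY pY) {M : Finset (J × K)} (hM : M.Nonempty)
    (hc : HasCovMean P pX pY c Z) {I I' : Fin 4 ↪ Fin n} (hI : ¬ MeetsTwice I I') :
    ∫ w, centredPart pX pY c M (Z (I 0) w) (Z (I 1) w) (Z (I 2) w) (Z (I 3) w) *
      centredPart pX pY c M (Z (I' 0) w) (Z (I' 1) w) (Z (I' 2) w) (Z (I' 3) w) ∂P = 0 := by
  have hne : ∀ s t, s ≠ t → I s ≠ I t := fun s t hst hh => hst (I.injective hh)
  set Q' : Ω → ℝ := fun w =>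
    centredPart pX pY c M (Z (I' 0) w) (Z (I' 1) w) (Z (I' 2) w) (Z (I' 3) w) with hQ'
  have hQL : MemLp Q' 2 P := (h.centredPart_moment hA hX hY hM hc I').1
  have hint : ∀ jk, Integrable (fun w => (covKernel pX pY jk (Z (I 0) w) (Z (I 1) w) - c jk) *
      (covKernel pX pY jk (Z (I 2) w) (Z (I 3) w) - c jk) * Q' w) P := by
    intro jk
    have h1 := (h.centredPart_moment hA hX hY (Finset.singleton_nonempty jk) hc I).1
    simp only [centredPart, Finset.sum_singleton] at h1
    exact h1.integrable_mul hQL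
  have hexp : ∀ w, centredPart pX pY c M (Z (I 0) w) (Z (I 1) w) (Z (I 2) w) (Z (I 3) w) * Q' w =
      ∑ jk ∈ M, (covKernel pX pY jk (Z (I 0) w) (Z (I 1) w) - c jk) *
      (covKernel pX pY jk (Z (I 2) w) (Z (I 3) w) - c jk) * Q' w := by
    intro w
    simp only [centredPart, Finset.sum_mul]
  refine (integral_congr_ae (Filter.Eventually.of_forall hexp)).trans ?_
  rw [integral_finsetSum _ fun jk _ => hint jk]
  refine Finset.sum_eq_zero fun jk _ => ?_
  have hG := measurable_covKernel hX hY jk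
  have hQm := measurable_centredPart (c := c) hX hY M
  have hprod : ∀ (T : Finset (Fin n)) (i₁ i₂ i₃ i₄ i₅ i₆ : T), Measurable fun v : T → 𝒳 × 𝒴 =>
      (covKernel pX pY jk (v i₁) (v i₂) - c jk) *
        centredPart pX pY c M (v i₃) (v i₄) (v i₅) (v i₆) := by
    intro T i₁ i₂ i₃ i₄ i₅ i₆
    have m1 := hG.comp (measurable_eval_pair i₁ i₂)
    have m2 := hQm.comp ((measurable_eval_pair i₃ i₄).prodMk (measurable_eval_pair i₅ i₆))
    exact (m1.sub_const (c jk)).mul m2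
  rw [MeetsTwice, not_and_or] at hI
  rcases hI with hI | hI <;> push Not at hI
  · obtain ⟨T, h0, h1, h2, h3, hT⟩ : ∃ T : Finset (Fin n),
        I 0 ∉ T ∧ I 1 ∉ T ∧ I 2 ∈ T ∧ I 3 ∈ T ∧ ∀ t, I' t ∈ T :=
      ⟨{I 0, I 1}ᶜ, by simp, by simp, by simp, by simp, fun t => by
        simp [(hI t).1.symm, (hI t).2.symm]⟩
    have hψ : Measurable fun v : T → 𝒳 × 𝒴 =>
        (covKernel pX pY jk (v ⟨I 2, h2⟩) (v ⟨I 3, h3⟩) - c jk) *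
        centredPart pX pY c M (v ⟨I' 0, hT 0⟩) (v ⟨I' 1, hT 1⟩) (v ⟨I' 2, hT 2⟩)
          (v ⟨I' 3, hT 3⟩) :=
      hprod T ⟨I 2, h2⟩ ⟨I 3, h3⟩ ⟨I' 0, hT 0⟩ ⟨I' 1, hT 1⟩ ⟨I' 2, hT 2⟩ ⟨I' 3, hT 3⟩
    have hz := h.integral_pair_mul_eq_zero h0 h1 (hG.sub_const _) hψ
      (h.integral_centred_eq_zero hA hX hY hc jk (hne 0 1 (by decide)))
    rw [← hz]
    refine integral_congr_ae (Filter.Eventually.of_forall fun w => ?_)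
    simp only [hQ']
    ring
  · obtain ⟨T, h2, h3, h0, h1, hT⟩ : ∃ T : Finset (Fin n),
        I 2 ∉ T ∧ I 3 ∉ T ∧ I 0 ∈ T ∧ I 1 ∈ T ∧ ∀ t, I' t ∈ T :=
      ⟨{I 2, I 3}ᶜ, by simp, by simp, by simp, by simp, fun t => by
        simp [(hI t).1.symm, (hI t).2.symm]⟩
    have hψ : Measurable fun v : T → 𝒳 × 𝒴 =>
        (covKernel pX pY jk (v ⟨I 0, h0⟩) (v ⟨I 1, h1⟩) - c jk) *
        centredPart pX pY c M (v ⟨I' 0, hT 0⟩) (v ⟨I' 1, hT 1⟩) (v ⟨I' 2, hT 2⟩)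
          (v ⟨I' 3, hT 3⟩) :=
      hprod T ⟨I 0, h0⟩ ⟨I 1, h1⟩ ⟨I' 0, hT 0⟩ ⟨I' 1, hT 1⟩ ⟨I' 2, hT 2⟩ ⟨I' 3, hT 3⟩
    have hz := h.integral_pair_mul_eq_zero h2 h3 (hG.sub_const _) hψ
      (h.integral_centred_eq_zero hA hX hY hc jk (hne 2 3 (by decide)))
    rw [← hz]
    refine integral_congr_ae (Filter.Eventually.of_forall fun w => ?_)
    simp only [hQ']
    ring

theorem integral_linearPart_mul_eq_zero (h : IsDominatedSample P μX μY A Z) (hA : 1 ≤ A)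
    (hX : IsONBasisL2 μX pX) (hY : IsONBasisL2 μY pY) (M : Finset (J × K))
    (hc : HasCovMean P pX pY c Z) {i j i' j' : Fin n} (hij : i ≠ j)
    (h1 : i' ≠ i) (h2 : i' ≠ j) (h3 : j' ≠ i) (h4 : j' ≠ j) :
    ∫ w, linearPart pX pY c M (Z i w) (Z j w) * linearPart pX pY c M (Z i' w) (Z j' w) ∂P = 0 := by
  have hl := measurable_linearPart (c := c) hX hY M
  obtain ⟨T, hi, hj, hi', hj'⟩ : ∃ T : Finset (Fin n), i ∉ T ∧ j ∉ T ∧ i' ∈ T ∧ j' ∈ T :=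
    ⟨{i, j}ᶜ, by simp, by simp, by simp [h1, h2], by simp [h3, h4]⟩
  have hψ : Measurable fun v : T → 𝒳 × 𝒴 => linearPart pX pY c M (v ⟨i', hi'⟩) (v ⟨j', hj'⟩) := by
    have m := hl.comp (measurable_eval_pair (ι := T) ⟨i', hi'⟩ ⟨j', hj'⟩)
    exact m
  exact h.integral_pair_mul_eq_zero hi hj hl hψ (h.linearPart_moment hA hX hY M hc hij).2.1

/-- Mean squared error of the U-statistic. -/
theorem integral_Dhat_sub_sq_le (h : IsDominatedSample P μX μY A Z) (hA : 1 ≤ A)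
    (hX : IsONBasisL2 μX pX) (hY : IsONBasisL2 μY pY) {M : Finset (J × K)} (hM : M.Nonempty)
    (hc : HasCovMean P pX pY c Z) (hn : 6 ≤ n) :
    ∫ w, (Dhat pX pY M (fun k => Z k w) - ∑ jk ∈ M, c jk ^ 2) ^ 2 ∂P ≤
      2 ^ 14 * A ^ 2 * (∑ jk ∈ M, c jk ^ 2) / n + 2 ^ 20 * A ^ 4 * M.card / (n : ℝ) ^ 2 := by
  have hD : 0 ≤ ∑ jk ∈ M, c jk ^ 2 := Finset.sum_nonneg fun _ _ => sq_nonneg _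
  set L : (Fin 4 ↪ Fin n) → Ω → ℝ := fun I w =>
    linearPart pX pY c M (Z (I 0) w) (Z (I 1) w) + linearPart pX pY c M (Z (I 2) w) (Z (I 3) w)
    with hLdef
  set Q : (Fin 4 ↪ Fin n) → Ω → ℝ := fun I w =>
    centredPart pX pY c M (Z (I 0) w) (Z (I 1) w) (Z (I 2) w) (Z (I 3) w) with hQdef
  have hne : ∀ (I : Fin 4 ↪ Fin n) s t, s ≠ t → I s ≠ I t :=
    fun I s t hst hh => hst (I.injective hh)
  have hl := fun I : Fin 4 ↪ Fin n =>
    h.linearPart_moment hA hX hY M hc (hne I 0 1 (by decide))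
  have hr := fun I : Fin 4 ↪ Fin n =>
    h.linearPart_moment hA hX hY M hc (hne I 2 3 (by decide))
  have hLL : ∀ I, MemLp (L I) 2 P := fun I => (hl I).1.add (hr I).1
  have hQL : ∀ I, MemLp (Q I) 2 P := fun I => (h.centredPart_moment hA hX hY hM hc I).1
  have hL2 : ∀ I, ∫ w, L I w ^ 2 ∂P ≤ 64 * A ^ 2 * ∑ jk ∈ M, c jk ^ 2 := by
    intro I
    have h1 : ∫ w, L I w ^ 2 ∂P ≤ ∫ w, (2 * linearPart pX pY c M (Z (I 0) w) (Z (I 1) w) ^ 2 +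
        2 * linearPart pX pY c M (Z (I 2) w) (Z (I 3) w) ^ 2) ∂P := by
      refine integral_mono (hLL I).integrable_sq
        (((hl I).1.integrable_sq.const_mul 2).add ((hr I).1.integrable_sq.const_mul 2))
        fun w => ?_
      simp only [hLdef]
      nlinarith [sq_nonneg (linearPart pX pY c M (Z (I 0) w) (Z (I 1) w) -
        linearPart pX pY c M (Z (I 2) w) (Z (I 3) w))]
    rw [integral_add ((hl I).1.integrable_sq.const_mul 2) ((hr I).1.integrable_sq.const_mul 2),
      integral_const_mul, integral_const_mul] at h1
    linarith [(hl I).2.2, (hr I).2.2]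
  have hL0 : ∀ I I', ¬ Meets I I' → ∫ w, L I w * L I' w ∂P = 0 := by
    intro I I' hI
    have hd : ∀ s t, I' t ≠ I s := fun s t hst => hI ⟨s, t, hst.symm⟩
    have e : ∀ w, L I w * L I' w =
        linearPart pX pY c M (Z (I 0) w) (Z (I 1) w) *
          linearPart pX pY c M (Z (I' 0) w) (Z (I' 1) w) +
        linearPart pX pY c M (Z (I 0) w) (Z (I 1) w) *
          linearPart pX pY c M (Z (I' 2) w) (Z (I' 3) w) +
        linearPart pX pY c M (Z (I 2) w) (Z (I 3) w) *
          linearPart pX pY c M (Z (I' 0) w) (Z (I' 1) w) +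
        linearPart pX pY c M (Z (I 2) w) (Z (I 3) w) *
          linearPart pX pY c M (Z (I' 2) w) (Z (I' 3) w) := fun w => by
      simp only [hLdef]
      ring
    have i1 : Integrable (fun w => linearPart pX pY c M (Z (I 0) w) (Z (I 1) w) *
        linearPart pX pY c M (Z (I' 0) w) (Z (I' 1) w)) P := (hl I).1.integrable_mul (hl I').1
    have i2 : Integrable (fun w => linearPart pX pY c M (Z (I 0) w) (Z (I 1) w) *
        linearPart pX pY c M (Z (I' 2) w) (Z (I' 3) w)) P := (hl I).1.integrable_mul (hr I').1
    have i3 : Integrable (fun w => linearPart pX pY c M (Z (I 2) w) (Z (I 3) w) *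
        linearPart pX pY c M (Z (I' 0) w) (Z (I' 1) w)) P := (hr I).1.integrable_mul (hl I').1
    have i4 : Integrable (fun w => linearPart pX pY c M (Z (I 2) w) (Z (I 3) w) *
        linearPart pX pY c M (Z (I' 2) w) (Z (I' 3) w)) P := (hr I).1.integrable_mul (hr I').1
    have z := fun (s t s' t' : Fin 4) (hst : s ≠ t) =>
      h.integral_linearPart_mul_eq_zero hA hX hY M hc (hne I s t hst)
        (hd s s') (hd t s') (hd s t') (hd t t')
    have i12 := i1.add i2
    have i123 := i12.add i3
    simp only [Pi.add_def] at i12 i123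
    simp only [e]
    rw [integral_add i123 i4, integral_add i12 i3, integral_add i1 i2, z 2 3 2 3 (by decide),
      z 2 3 0 1 (by decide), z 0 1 2 3 (by decide), z 0 1 0 1 (by decide)]
    simp
  -- Linear terms are uncorrelated unless the quadruples meet, which leaves n³ partners up to a
  -- constant; doubly centred terms need both halves of I to meet I', which leaves n². Division by N
  -- of order n⁴ gives the rates 1/n and 1/n².
  have hsumL := sum_integral_sum_sq_le (σ := Unit) (fun _ => L) Meets (fun _ => hLL)
    (fun _ => hL2) (by positivity) (fun I I' hI => by simpa using hL0 I I' hI) card_meets_le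
  have hsumQ := sum_integral_sum_sq_le (σ := Unit) (fun _ => Q) MeetsTwice (fun _ => hQL)
    (fun _ I => (h.centredPart_moment hA hX hY hM hc I).2) (by positivity)
    (fun I I' hI => by simpa using h.integral_centredPart_mul_eq_zero hA hX hY hM hc hI)
    card_meetsTwice_le
  simp only [Finset.univ_unique, Finset.sum_singleton, Fintype.card_unit, Nat.cast_one,
    one_mul] at hsumL hsumQ
  have hN := pow_four_le_card_embedding hn
  have hn0 : (0 : ℝ) < n := by
    have : 0 < n := by omega
    exact_mod_cast this
  have hNpos : (0 : ℝ) < Fintype.card (Fin 4 ↪ Fin n) := by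
    have := pow_pos hn0 4
    linarith
  have hdec : ∀ w, Dhat pX pY M (fun k => Z k w) - ∑ jk ∈ M, c jk ^ 2 =
      (Fintype.card (Fin 4 ↪ Fin n) : ℝ)⁻¹ * (∑ I, L I w + ∑ I, Q I w) := by
    intro w
    rw [Dhat_eq_sum_covQuad]
    simp only [covQuad_decomposition pX pY c M, Finset.sum_add_distrib, hLdef, hQdef]
    rw [mul_add, Finset.sum_const, Finset.card_univ, nsmul_eq_mul, inv_mul_cancel_left₀ hNpos.ne']
    ring
  simp only [hdec]
  set N : ℝ := (Fintype.card (Fin 4 ↪ Fin n) : ℝ)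
  set D := ∑ jk ∈ M, c jk ^ 2
  have hLS : MemLp (fun w => ∑ I, L I w) 2 P := memLp_finsetSum _ fun I _ => hLL I
  have hQS : MemLp (fun w => ∑ I, Q I w) 2 P := memLp_finsetSum _ fun I _ => hQL I
  have hbound : ∫ w, (N⁻¹ * (∑ I, L I w + ∑ I, Q I w)) ^ 2 ∂P ≤
      ∫ w, N⁻¹ ^ 2 * (2 * (∑ I, L I w) ^ 2 + 2 * (∑ I, Q I w) ^ 2) ∂P := by
    refine integral_mono ((hLS.add hQS).const_mul N⁻¹).integrable_sq
      (((hLS.integrable_sq.const_mul 2).add (hQS.integrable_sq.const_mul 2)).const_mul _)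
      fun w => ?_
    simp only [mul_pow]
    refine mul_le_mul_of_nonneg_left ?_ (by positivity)
    nlinarith [sq_nonneg (∑ I, L I w - ∑ I, Q I w)]
  refine hbound.trans ?_
  rw [integral_const_mul, integral_add (hLS.integrable_sq.const_mul 2)
    (hQS.integrable_sq.const_mul 2), integral_const_mul, integral_const_mul]
  have h1 : N⁻¹ ^ 2 * (2 * ∫ w, (∑ I, L I w) ^ 2 ∂P + 2 * ∫ w, (∑ I, Q I w) ^ 2 ∂P) ≤
      N⁻¹ ^ 2 * (2 * (N * ((16 * n ^ 3 : ℕ) * (64 * A ^ 2 * D))) +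
        2 * (N * ((256 * n ^ 2 : ℕ) * (256 * A ^ 4 * M.card)))) := by
    refine mul_le_mul_of_nonneg_left ?_ (by positivity)
    linarith
  refine h1.trans ?_
  have h2 : N⁻¹ ^ 2 * (2 * (N * ((16 * n ^ 3 : ℕ) * (64 * A ^ 2 * D))) +
        2 * (N * ((256 * n ^ 2 : ℕ) * (256 * A ^ 4 * M.card)))) =
      2 ^ 11 * A ^ 2 * D * n ^ 3 / N + 2 ^ 17 * A ^ 4 * M.card * n ^ 2 / N := by
    field_simp
    push_cast
    ring
  rw [h2]
  refine add_le_add ?_ ?_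
  · rw [div_le_div_iff₀ hNpos hn0]
    have h3 : 0 ≤ A ^ 2 * D := by positivity
    nlinarith [mul_le_mul_of_nonneg_left hN h3]
  · rw [div_le_div_iff₀ hNpos (by positivity)]
    have h3 : 0 ≤ A ^ 4 * M.card := by positivity
    nlinarith [mul_le_mul_of_nonneg_left hN h3]

end IsDominatedSample

end UnpermutedMoments

/-! ### Means of the covariance kernels and Parseval's identity for the dependence. -/

section Coefficients

variable {Ω 𝒳 𝒴 J K : Type*} [MeasurableSpace Ω] [MeasurableSpace 𝒳] [MeasurableSpace 𝒴]
  {P : Measure Ω} [IsProbabilityMeasure P]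
  {μX : Measure 𝒳} {μY : Measure 𝒴} [SigmaFinite μX] [SigmaFinite μY]
  {pX : J → 𝒳 → ℝ} {pY : K → 𝒴 → ℝ} {f : 𝒳 × 𝒴 → ℝ} {A : ℝ} {n : ℕ} {Z : Fin n → Ω → 𝒳 × 𝒴}

/-- The coefficients of `f - f_X f_Y`. -/
def dependenceCoeff (μX : Measure 𝒳) (μY : Measure 𝒴) (pX : J → 𝒳 → ℝ) (pY : K → 𝒴 → ℝ)
    (f : 𝒳 × 𝒴 → ℝ) (jk : J × K) : ℝ :=
  coeff μX μY pX pY f jk - coeffX μX μY pX f jk.1 * coeffY μX μY pY f jk.2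

theorem IsIIDSample.integral_comp (h : IsIIDSample P μX μY f Z) (hf : IsDensity μX μY f)
    {g : 𝒳 × 𝒴 → ℝ} (hg : Measurable g) {i : Fin n} (hi : Integrable (fun w => g (Z i w)) P) :
    Integrable (fun z => f z * g z) (μX.prod μY) ∧
      ∫ w, g (Z i w) ∂P = ∫ z, f z * g z ∂(μX.prod μY) := by
  have hae : (fun z => (ENNReal.ofReal (f z)).toReal • g z) =ᵐ[μX.prod μY] fun z => f z * g z := by
    filter_upwards [hf.nonneg] with z hz
    rw [ENNReal.toReal_ofReal hz, smul_eq_mul]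
  have hfm := hf.measurable.ennreal_ofReal
  have hlt : ∀ᵐ z ∂(μX.prod μY), ENNReal.ofReal (f z) < ∞ :=
    Filter.Eventually.of_forall fun _ => ENNReal.ofReal_lt_top
  constructor
  · have h1 : Integrable g (P.map (Z i)) :=
      (integrable_map_measure hg.aestronglyMeasurable (h.measurable i).aemeasurable).2 hi
    rw [h.law i, integrable_withDensity_iff_integrable_smul' hfm hlt] at h1
    exact h1.congr hae
  · have h1 := integral_map (h.measurable i).aemeasurable
      (hg.aestronglyMeasurable (μ := P.map (Z i)))
    rw [← h1, h.law i, integral_withDensity_eq_integral_toReal_smul hfm hlt,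
      integral_congr_ae hae]

theorem IsDominatedSample.memLp_fst (h : IsDominatedSample P μX μY A Z)
    (hX : IsONBasisL2 μX pX) (j : J) (i : Fin n) :
    MemLp (fun w => pX j (Z i w).1) 2 P := by
  have h1 : MemLp (pX j) 2 (P.map fun w => (Z i w).1) :=
    ((hX.memLp j).smul_measure ENNReal.ofReal_ne_top).mono_measure (h.map_fst_le i)
  exact (memLp_map_measure_iff (hX.1 j).aestronglyMeasurable
    (measurable_fst.comp (h.measurable i)).aemeasurable).1 h1

theorem IsDominatedSample.memLp_snd (h : IsDominatedSample P μX μY A Z)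
    (hY : IsONBasisL2 μY pY) (k : K) (i : Fin n) :
    MemLp (fun w => pY k (Z i w).2) 2 P := by
  have h1 : MemLp (pY k) 2 (P.map fun w => (Z i w).2) :=
    ((hY.memLp k).smul_measure ENNReal.ofReal_ne_top).mono_measure (h.map_snd_le i)
  exact (memLp_map_measure_iff (hY.1 k).aestronglyMeasurable
    (measurable_snd.comp (h.measurable i)).aemeasurable).1 h1

/-- Of the four products in the kernel, the two with equal indices have mean a_jk and the two with
distinct indices factor by independence into the product of the marginal coefficients. -/
theorem IsIIDSample.hasCovMean (h : IsIIDSample P μX μY f Z) (hf : IsDensity μX μY f)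
    (hd : IsDominatedSample P μX μY A Z) (hA : 1 ≤ A) (hX : IsONBasisL2 μX pX)
    (hY : IsONBasisL2 μY pY) :
    HasCovMean P pX pY (dependenceCoeff μX μY pX pY f) Z := by
  intro jk i j hij
  have hpp : ∀ a b, Integrable (fun w => prodBasis pX pY jk ((Z a w).1, (Z b w).2)) P := by
    intro a b
    have := (hd.linear_moment hA hX hY {jk} (fun _ => 1) a b).1.integrable one_le_two
    simpa using this
  have hjoint : ∀ a, ∫ w, prodBasis pX pY jk ((Z a w).1, (Z a w).2) ∂P =
      coeff μX μY pX pY f jk := fun a =>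
    (h.integral_comp hf (measurable_prodBasis hX hY jk) (hpp a a)).2
  have hx : ∀ a, ∫ w, pX jk.1 (Z a w).1 ∂P = coeffX μX μY pX f jk.1 := by
    intro a
    obtain ⟨h1, h2⟩ := h.integral_comp hf ((hX.1 jk.1).comp measurable_fst)
      ((hd.memLp_fst hX jk.1 a).integrable one_le_two)
    refine h2.trans ?_
    rw [integral_prod _ h1, coeffX]
    refine integral_congr_ae (Filter.Eventually.of_forall fun x => ?_)
    simp only [Function.comp, marginalX]
    rw [integral_mul_const]
  have hy : ∀ a, ∫ w, pY jk.2 (Z a w).2 ∂P = coeffY μX μY pY f jk.2 := by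
    intro a
    obtain ⟨h1, h2⟩ := h.integral_comp hf ((hY.1 jk.2).comp measurable_snd)
      ((hd.memLp_snd hY jk.2 a).integrable one_le_two)
    refine h2.trans ?_
    rw [integral_prod_symm _ h1, coeffY]
    refine integral_congr_ae (Filter.Eventually.of_forall fun y => ?_)
    simp only [Function.comp, marginalY]
    rw [integral_mul_const]
  have hcross : ∀ a b, a ≠ b → ∫ w, prodBasis pX pY jk ((Z a w).1, (Z b w).2) ∂P =
      coeffX μX μY pX f jk.1 * coeffY μX μY pY f jk.2 := by
    intro a b hab
    have hind : IndepFun (fun w => pX jk.1 (Z a w).1) (fun w => pY jk.2 (Z b w).2) P :=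
      (h.indep.indepFun hab).comp ((hX.1 jk.1).comp measurable_fst)
        ((hY.1 jk.2).comp measurable_snd)
    rw [← hx a, ← hy b]
    exact hind.integral_fun_mul_eq_mul_integral (hd.memLp_fst hX jk.1 a).1
      (hd.memLp_snd hY jk.2 b).1
  have e : ∀ w, covKernel pX pY jk (Z i w) (Z j w) =
      (prodBasis pX pY jk ((Z i w).1, (Z i w).2) - prodBasis pX pY jk ((Z i w).1, (Z j w).2) -
        (prodBasis pX pY jk ((Z j w).1, (Z i w).2) -
          prodBasis pX pY jk ((Z j w).1, (Z j w).2))) / 2 := by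
    intro w
    simp only [covKernel, prodBasis]
    ring
  simp only [e]
  have i1 := (hpp i i).sub (hpp i j)
  have i2 := (hpp j i).sub (hpp j j)
  simp only [Pi.sub_def] at i1 i2
  rw [integral_div, integral_sub i1 i2, integral_sub (hpp i i) (hpp i j),
    integral_sub (hpp j i) (hpp j j), hjoint, hjoint, hcross i j hij, hcross j i hij.symm,
    dependenceCoeff]
  ring

/-- Parseval's identity for the measure of dependence. -/
theorem tsum_dependenceCoeff_sq [Countable K] (hX : IsONBasisL2 μX pX) (hY : IsONBasisL2 μY pY)
    (hf : IsDensity μX μY f) (hA : 0 ≤ A)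
    (hbX : supNorm (marginalX μY f) ≤ ENNReal.ofReal A)
    (hbY : supNorm (marginalY μX f) ≤ ENNReal.ofReal A) :
    ∑' jk, ENNReal.ofReal (dependenceCoeff μX μY pX pY f jk ^ 2) =
      ENNReal.ofReal (dependence μX μY f) := by
  -- Bounded integrable marginals are square-integrable, so f_X f_Y, and hence f - f_X f_Y, lies in
  -- L² of the product.
  have hLX : MemLp (marginalX μY f) 2 μX :=
    memLp_two_of_bounded hf.integrable.integral_prod_left (abs_le_of_supNorm_le hA hbX)
  have hLY : MemLp (marginalY μX f) 2 μY :=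
    memLp_two_of_bounded hf.integrable.integral_prod_right (abs_le_of_supNorm_le hA hbY)
  have hmm : Measurable fun z : 𝒳 × 𝒴 => marginalX μY f z.1 * marginalY μX f z.2 :=
    (hf.measurable_marginalX.comp measurable_fst).mul
      (hf.measurable_marginalY.comp measurable_snd)
  have hLm : MemLp (fun z : 𝒳 × 𝒴 => marginalX μY f z.1 * marginalY μX f z.2) 2
      (μX.prod μY) := by
    rw [memLp_two_iff_integrable_sq hmm.aestronglyMeasurable]
    simpa only [mul_pow] using hLX.integrable_sq.mul_prod hLY.integrable_sq
  have hLg := hf.memLp.sub hLm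
  have hP := tsum_ofReal_sq_prodBasis hX hY (hf.measurable.sub hmm) hLg
  rw [lintegral_ofReal_sq hLg] at hP
  refine Eq.trans (tsum_congr fun jk => ?_) hP
  congr 2
  have e : ∀ z : 𝒳 × 𝒴, (f - fun z : 𝒳 × 𝒴 => marginalX μY f z.1 * marginalY μX f z.2) z *
      prodBasis pX pY jk z = f z * prodBasis pX pY jk z -
        (marginalX μY f z.1 * pX jk.1 z.1) * (marginalY μX f z.2 * pY jk.2 z.2) := by
    intro z
    simp only [Pi.sub_apply, prodBasis]
    ring
  simp only [e]
  have i1 : Integrable (fun z => f z * prodBasis pX pY jk z) (μX.prod μY) :=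
    hf.memLp.integrable_mul (memLp_prodBasis hX hY jk)
  have i2 : Integrable (fun z : 𝒳 × 𝒴 => (marginalX μY f z.1 * pX jk.1 z.1) *
      (marginalY μX f z.2 * pY jk.2 z.2)) (μX.prod μY) :=
    (hLX.integrable_mul (hX.memLp jk.1)).mul_prod (hLY.integrable_mul (hY.memLp jk.2))
  rw [integral_sub i1 i2, integral_prod_mul (fun x => marginalX μY f x * pX jk.1 x)
      (fun y => marginalY μX f y * pY jk.2 y)]
  rfl

end Coefficients

/-! ### The truncation level and the truncation loss. -/

section Truncation

variable {J K : Type*} {ω : ℕ+ ↪ J × K} {θ : J × K → ℝ≥0∞} {θ₀ t : ℝ}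

/-- The bound `θ₀ ≤ θ (ω N)` puts N in the defining set, so the infimum is attained; over an empty
set `sInf` would be 0 and say nothing. -/
theorem IsOrderedWeight.m₀_spec (hθ : IsOrderedWeight ω θ₀ θ) (N : ℕ+)
    (hN : t < Real.sqrt N * θ₀ ^ 2) (hθ₀ : 0 < θ₀) :
    m₀ ω θ t ≤ N ∧ ∃ k : ℕ+, (k : ℕ) = m₀ ω θ t ∧
      ENNReal.ofReal t < ENNReal.ofReal (Real.sqrt (m₀ ω θ t)) * θ (ω k) ^ 2 := by
  have hmem : (N : ℕ) ∈ {m : ℕ | ∃ k : ℕ+, (k : ℕ) = m ∧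
      ENNReal.ofReal t < ENNReal.ofReal (Real.sqrt m) * θ (ω k) ^ 2} := by
    refine ⟨N, rfl, ?_⟩
    have h1 : ENNReal.ofReal θ₀ ≤ θ (ω N) := hθ.le_first.trans (hθ.mono one_le)
    have hs : 0 < Real.sqrt N := Real.sqrt_pos.2 (by exact_mod_cast N.pos)
    calc ENNReal.ofReal t < ENNReal.ofReal (Real.sqrt N * θ₀ ^ 2) :=
          (ENNReal.ofReal_lt_ofReal_iff (by positivity)).2 hN
      _ = ENNReal.ofReal (Real.sqrt N) * ENNReal.ofReal θ₀ ^ 2 := by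
          rw [ENNReal.ofReal_mul hs.le, ENNReal.ofReal_pow hθ₀.le]
      _ ≤ _ := by gcongr
  exact ⟨Nat.sInf_le hmem, Nat.sInf_mem ⟨_, hmem⟩⟩

variable {𝒳 𝒴 : Type*} [MeasurableSpace 𝒳] [MeasurableSpace 𝒴]
  {μX : Measure 𝒳} {μY : Measure 𝒴} [SigmaFinite μX] [SigmaFinite μY]
  {pX : J → 𝒳 → ℝ} {pY : K → 𝒴 → ℝ} {f : 𝒳 × 𝒴 → ℝ} {A r ρ : ℝ}

/-- The loss from truncating the expansion of the measure of dependence. -/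
theorem IsAlternative.dependence_le [Countable K] (hX : IsONBasisL2 μX pX)
    (hY : IsONBasisL2 μY pY) (hf : IsAlternative μX μY pX pY θ r A ρ f) (hA : 0 ≤ A)
    (hθ : IsOrderedWeight ω θ₀ θ) (ht : 0 < t) {k m : ℕ+} (hkm : k ≤ m) {s : ℝ} (hs : 0 ≤ s)
    (hk : ENNReal.ofReal t ≤ ENNReal.ofReal s * θ (ω k) ^ 2) :
    dependence μX μY f ≤
      ∑ jk ∈ truncationSet ω m, dependenceCoeff μX μY pX pY f jk ^ 2 + s / t * r ^ 2 := by
  classical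
  set c := dependenceCoeff μX μY pX pY f
  set M := truncationSet ω m with hMdef
  have hS : ∑' jk, θ jk ^ 2 * ENNReal.ofReal (c jk ^ 2) ≤ ENNReal.ofReal (r ^ 2) :=
    hf.smoothness_le
  -- Outside M a finite weight satisfies 1 ≤ (s/t) θ², by monotonicity beyond k, so the tail of the
  -- Parseval sum is at most s/t times the smoothness.
  have hpt : ∀ jk, ENNReal.ofReal (c jk ^ 2) ≤ (if jk ∈ M then ENNReal.ofReal (c jk ^ 2) else 0) +
      ENNReal.ofReal (s / t) * (θ jk ^ 2 * ENNReal.ofReal (c jk ^ 2)) := by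
    intro jk
    by_cases hM : jk ∈ M
    · simp [hM]
    rw [if_neg hM, zero_add]
    by_cases hfin : θ jk < ∞
    · obtain ⟨l, -, rfl⟩ := hθ.bijOn.surjOn hfin
      have hml : m < l := by
        by_contra hlm
        exact hM (Finset.mem_map_of_mem ω
          (Finset.mem_Icc.2 ⟨one_le, not_lt.1 hlm⟩))
      have h1 : θ (ω k) ≤ θ (ω l) := hθ.mono (hkm.trans hml.le)
      have h2 : ENNReal.ofReal t ≤ ENNReal.ofReal s * θ (ω l) ^ 2 := hk.trans (by gcongr)
      have h3 : 1 ≤ ENNReal.ofReal (s / t) * θ (ω l) ^ 2 := by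
        rw [ENNReal.ofReal_div_of_pos ht, ENNReal.div_eq_inv_mul, mul_assoc,
          ← ENNReal.inv_mul_cancel (ENNReal.ofReal_pos.2 ht).ne' ENNReal.ofReal_ne_top]
        gcongr
      rw [← mul_assoc]
      exact le_mul_of_one_le_left zero_le h3
    -- At an infinite weight, finiteness of the smoothness forces the coefficient to vanish.
    · have htop : θ jk = ∞ := not_lt_top_iff.1 hfin
      have h1 : θ jk ^ 2 * ENNReal.ofReal (c jk ^ 2) ≠ ∞ :=
        ne_top_of_le_ne_top ENNReal.ofReal_ne_top ((ENNReal.le_tsum jk).trans hS)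
      have h2 : ENNReal.ofReal (c jk ^ 2) = 0 := by
        by_contra h0
        refine h1 ?_
        rw [htop, ENNReal.top_pow two_ne_zero, ENNReal.top_mul h0]
      simp [h2]
  have hsum := ENNReal.tsum_le_tsum hpt
  rw [tsum_dependenceCoeff_sq hX hY hf.isDensity hA hf.supNorm_marginalX_le
    hf.supNorm_marginalY_le, ENNReal.tsum_add, ENNReal.tsum_mul_left,
    tsum_eq_sum (s := M) (fun jk hjk => if_neg hjk),
    Finset.sum_congr rfl (fun jk hjk => if_pos hjk),
    ← ENNReal.ofReal_sum_of_nonneg fun jk _ => sq_nonneg (c jk)] at hsum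
  have h0 : 0 ≤ ∑ jk ∈ M, c jk ^ 2 := Finset.sum_nonneg fun _ _ => sq_nonneg _
  have hst : 0 ≤ s / t := div_nonneg hs ht.le
  refine (ENNReal.ofReal_le_ofReal_iff (by positivity)).1 (hsum.trans ?_)
  rw [ENNReal.ofReal_add h0 (by positivity), ENNReal.ofReal_mul hst]
  gcongr

end Truncation

/-! ### From moment bounds to a bound on the p-value. -/

section PermutationTest

variable {Ω 𝒳 𝒴 J K : Type*} [MeasurableSpace Ω] [MeasurableSpace 𝒳] [MeasurableSpace 𝒴]
  {P : Measure Ω} [IsProbabilityMeasure P]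
  {μX : Measure 𝒳} {μY : Measure 𝒴} [SigmaFinite μX] [SigmaFinite μY]
  {pX : J → 𝒳 → ℝ} {pY : K → 𝒴 → ℝ} {A : ℝ} {n B : ℕ} {Z : Fin n → Ω → 𝒳 × 𝒴}
  {π : Fin B → Ω → Equiv.Perm (Fin n)} {c : J × K → ℝ}

theorem measurable_Dhat (hX : IsONBasisL2 μX pX) (hY : IsONBasisL2 μY pY) (M : Finset (J × K)) :
    Measurable fun z : Fin n → 𝒳 × 𝒴 => Dhat pX pY M z := by
  have hp := fun (jk : J × K) (i j : Fin n) => (measurable_prodBasis hX hY jk).comp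
    ((measurable_fst.comp (measurable_pi_apply (X := fun _ : Fin n => 𝒳 × 𝒴) i)).prodMk
      (measurable_snd.comp (measurable_pi_apply (X := fun _ : Fin n => 𝒳 × 𝒴) j)))
  refine (Finset.measurable_fun_sum _ fun I _ => Finset.measurable_fun_sum _ fun jk _ => ?_).const_mul _
  exact (((hp jk (I 0) (I 0)).mul (hp jk (I 1) (I 1))).sub
    (((hp jk (I 0) (I 0)).mul (hp jk (I 1) (I 2))).const_mul 2)).add
    ((hp jk (I 0) (I 1)).mul (hp jk (I 2) (I 3)))

theorem measurable_permute (σ : Equiv.Perm (Fin n)) :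
    Measurable fun z : Fin n → 𝒳 × 𝒴 => permute σ z :=
  measurable_pi_lambda _ fun i => (measurable_fst.comp (measurable_pi_apply i)).prodMk
    (measurable_snd.comp (measurable_pi_apply (σ i)))

theorem measurableSet_Dhat_le (hX : IsONBasisL2 μX pX) (hY : IsONBasisL2 μY pY)
    (M : Finset (J × K)) (σ : Equiv.Perm (Fin n)) :
    MeasurableSet {z : Fin n → 𝒳 × 𝒴 | Dhat pX pY M z ≤ Dhat pX pY M (permute σ z)} :=
  measurableSet_le (measurable_Dhat hX hY M) ((measurable_Dhat hX hY M).comp (measurable_permute σ))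

/-- Averaging an event over a uniform permutation independent of the sample. -/
theorem IsUniformPerms.measureReal_le (h : IsUniformPerms P Z π)
    (b : Fin B) {G : Equiv.Perm (Fin n) → Set (Fin n → 𝒳 × 𝒴)} (hG : ∀ σ, MeasurableSet (G σ)) :
    P.real {w | (fun k => Z k w) ∈ G (π b w)} ≤
      (Nat.factorial n : ℝ)⁻¹ * ∑ σ, P.real {w | (fun k => Z k w) ∈ G σ} := by
  have hsub : {w | (fun k => Z k w) ∈ G (π b w)} ⊆
      ⋃ σ ∈ (Finset.univ : Finset (Equiv.Perm (Fin n))),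
        {w | (fun k => Z k w) ∈ G σ} ∩ {w | π b w = σ} := by
    intro w hw
    simp only [Set.mem_iUnion]
    exact ⟨π b w, Finset.mem_univ _, hw, rfl⟩
  refine (measureReal_mono hsub (measure_ne_top _ _)).trans ((measureReal_biUnion_finset_le _ _).trans ?_)
  rw [Finset.mul_sum]
  refine Finset.sum_le_sum fun σ _ => le_of_eq ?_
  have hm : MeasurableSet {v : Fin B → Equiv.Perm (Fin n) | v b = σ} :=
    measurable_pi_apply (X := fun _ : Fin B => Equiv.Perm (Fin n)) b
      (MeasurableSpace.measurableSet_top (s := {σ}))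
  have hi := h.indep_sample.measure_inter_preimage_eq_mul _ _ (hG σ) hm
  have hu : P ((fun w b => π b w) ⁻¹' {v : Fin B → Equiv.Perm (Fin n) | v b = σ}) =
    1 / (Nat.factorial n : ℝ≥0∞) := h.uniform b σ
  rw [hu] at hi
  have hr := congrArg ENNReal.toReal hi
  rw [ENNReal.toReal_mul] at hr
  refine hr.trans ?_
  rw [mul_comm]
  congr 1
  simp

/-- Markov's inequality for the permutation p-value. -/
theorem IsUniformPerms.measureReal_le_pValue (h : IsUniformPerms P Z π)
    (hZ : ∀ k, Measurable (Z k)) (hX : IsONBasisL2 μX pX) (hY : IsONBasisL2 μY pY)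
    (M : Finset (J × K)) {a q : ℝ} (ha : 0 < a)
    (hq : ∀ b, P.real {w | Dhat pX pY M (fun k => Z k w) ≤
      Dhat pX pY M (permute (π b w) fun k => Z k w)} ≤ q) :
    P.real {w | a ≤ pValue pX pY M (fun k => Z k w) (fun b => π b w)} ≤
      (1 + B * q) / (1 + B) / a := by
  set E : Fin B → Set Ω := fun b => {w | Dhat pX pY M (fun k => Z k w) ≤
      Dhat pX pY M (permute (π b w) fun k => Z k w)} with hE
  have hZm : Measurable fun w k => Z k w := measurable_pi_lambda _ hZ
  have hEm : ∀ b, MeasurableSet (E b) := by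
    intro b
    have : E b = ⋃ σ : Equiv.Perm (Fin n), {w | π b w = σ} ∩ {w | (fun k => Z k w) ∈
        {z : Fin n → 𝒳 × 𝒴 | Dhat pX pY M z ≤ Dhat pX pY M (permute σ z)}} := by
      ext w
      simp [hE]
    rw [this]
    exact MeasurableSet.iUnion fun σ =>
      (h.measurable b (MeasurableSpace.measurableSet_top (s := {σ}))).inter
        (hZm (measurableSet_Dhat_le hX hY M σ))
  have hp : ∀ w, pValue pX pY M (fun k => Z k w) (fun b => π b w) =
      (1 + ∑ b, (E b).indicator (fun _ => (1 : ℝ)) w) / (1 + B) := fun w => rfl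
  have hint : ∀ b, Integrable ((E b).indicator fun _ => (1 : ℝ)) P := fun b =>
    (integrable_const _).indicator (hEm b)
  have hsum : Integrable (fun w => ∑ b, (E b).indicator (fun _ => (1 : ℝ)) w) P :=
    integrable_finsetSum _ fun b _ => hint b
  have hpi : Integrable (fun w => (1 + ∑ b, (E b).indicator (fun _ => (1 : ℝ)) w) / (1 + B)) P :=
    ((integrable_const _).add hsum).div_const _
  have hB : (0 : ℝ) < 1 + B := by positivity
  -- By linearity of expectation each permutation adds at most q, so the mean p-value is at most (1
  -- + Bq)/(1 + B).
  have hmk := mul_meas_ge_le_integral_of_nonneg (Filter.Eventually.of_forall fun w =>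
    div_nonneg (add_nonneg zero_le_one (Finset.sum_nonneg fun b _ =>
      Set.indicator_nonneg (fun _ _ => zero_le_one) w)) hB.le) hpi a
  rw [integral_div, integral_add (integrable_const _) hsum,
    integral_finsetSum _ fun b _ => hint b] at hmk
  simp only [integral_indicator_const _ (hEm _), integral_const, probReal_univ, smul_eq_mul,
    mul_one] at hmk
  simp only [hp]
  rw [le_div_iff₀ ha, mul_comm]
  refine hmk.trans (div_le_div_of_nonneg_right ?_ hB.le)
  have : ∑ b, P.real (E b) ≤ ∑ _b : Fin B, q := Finset.sum_le_sum fun b _ => hq b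
  simp only [Finset.sum_const, Finset.card_univ, Fintype.card_fin, nsmul_eq_mul] at this
  linarith

/-- The probability that the statistic of a randomly permuted sample is at least the original. -/
theorem IsDominatedSample.measureReal_Dhat_le (h : IsDominatedSample P μX μY A Z) (hA : 1 ≤ A)
    (hX : IsONBasisL2 μX pX) (hY : IsONBasisL2 μY pY) {M : Finset (J × K)} (hM : M.Nonempty)
    (hc : HasCovMean P pX pY c Z) (hn : 6 ≤ n) (hD : 0 < ∑ jk ∈ M, c jk ^ 2)
    (hπ : IsUniformPerms P Z π) (b : Fin B) :
    P.real {w | Dhat pX pY M (fun k => Z k w) ≤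
      Dhat pX pY M (permute (π b w) fun k => Z k w)} ≤
      2 ^ 16 * A ^ 2 / (n * ∑ jk ∈ M, c jk ^ 2) +
        2 ^ 23 * A ^ 4 * M.card / ((n : ℝ) ^ 2 * (∑ jk ∈ M, c jk ^ 2) ^ 2) := by
  have hV := h.integral_Dhat_sub_sq_le hA hX hY hM hc hn
  have hS := h.sum_perm_integral_Dhat_sq_le hA hX hY M hn
  set D := ∑ jk ∈ M, c jk ^ 2
  have hL := fun σ => h.memLp_Dhat_permute hA hX hY M σ
  have hLD : MemLp (fun w => Dhat pX pY M (fun k => Z k w) - D) 2 P :=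
    (hL 1).sub (memLp_const D)
  have hn0 : (0 : ℝ) < n := by
    have : 0 < n := by omega
    exact_mod_cast this
  have hD2 : 0 < (D / 2) ^ 2 := by positivity
  refine (hπ.measureReal_le b (fun σ => measurableSet_Dhat_le hX hY M σ)).trans ?_
  have hσ : ∀ σ, P.real {w | (fun k => Z k w) ∈
      {z : Fin n → 𝒳 × 𝒴 | Dhat pX pY M z ≤ Dhat pX pY M (permute σ z)}} ≤
      ((∫ w, (Dhat pX pY M (fun k => Z k w) - D) ^ 2 ∂P) +
        ∫ w, Dhat pX pY M (permute σ fun k => Z k w) ^ 2 ∂P) / (D / 2) ^ 2 := by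
    intro σ
    -- If the permuted statistic reaches the original one, either the original is at most D/2, hence
    -- off its mean by D/2, or the permuted one exceeds D/2. Chebyshev's inequality handles both.
    have hsub : {w | (fun k => Z k w) ∈
        {z : Fin n → 𝒳 × 𝒴 | Dhat pX pY M z ≤ Dhat pX pY M (permute σ z)}} ⊆
        {w | (D / 2) ^ 2 ≤ (Dhat pX pY M (fun k => Z k w) - D) ^ 2} ∪
        {w | (D / 2) ^ 2 ≤ Dhat pX pY M (permute σ fun k => Z k w) ^ 2} := by
      intro w hw
      simp only [Set.mem_ofPred_eq] at hw
      by_cases h1 : Dhat pX pY M (fun k => Z k w) ≤ D / 2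
      · left
        simp only [Set.mem_ofPred_eq]
        nlinarith
      · right
        simp only [Set.mem_ofPred_eq]
        nlinarith
    have m1 := mul_meas_ge_le_integral_of_nonneg
      (Filter.Eventually.of_forall fun w => sq_nonneg _) hLD.integrable_sq ((D / 2) ^ 2)
    have m2 := mul_meas_ge_le_integral_of_nonneg
      (Filter.Eventually.of_forall fun w => sq_nonneg _) (hL σ).integrable_sq ((D / 2) ^ 2)
    rw [le_div_iff₀ hD2, mul_comm]
    refine (mul_le_mul_of_nonneg_left ((measureReal_mono hsub).trans
      (measureReal_union_le _ _)) hD2.le).trans ?_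
    linarith
  have hfac : (0 : ℝ) < Nat.factorial n := by exact_mod_cast Nat.factorial_pos n
  refine (mul_le_mul_of_nonneg_left (Finset.sum_le_sum fun σ _ => hσ σ) (by positivity)).trans ?_
  rw [← Finset.sum_div, Finset.sum_add_distrib, Finset.sum_const, Finset.card_univ,
    Fintype.card_perm, Fintype.card_fin, nsmul_eq_mul]
  have h1 : (Nat.factorial n : ℝ) * (∫ w, (Dhat pX pY M (fun k => Z k w) - D) ^ 2 ∂P) +
      ∑ σ : Equiv.Perm (Fin n), ∫ w, Dhat pX pY M (permute σ fun k => Z k w) ^ 2 ∂P ≤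
      Nat.factorial n * (2 ^ 14 * A ^ 2 * D / n + 2 ^ 21 * A ^ 4 * M.card / (n : ℝ) ^ 2) := by
    have h2 : 0 ≤ A ^ 4 * M.card / (n : ℝ) ^ 2 := by positivity
    have h3 : 2 ^ 14 * A ^ 2 * D / n + 2 ^ 20 * A ^ 4 * M.card / (n : ℝ) ^ 2 +
        2 ^ 15 * A ^ 4 * M.card / (n : ℝ) ^ 2 ≤
        2 ^ 14 * A ^ 2 * D / n + 2 ^ 21 * A ^ 4 * M.card / (n : ℝ) ^ 2 := by
      simp only [mul_assoc, mul_div_assoc] at h2 ⊢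
      linarith
    refine le_trans ?_ (mul_le_mul_of_nonneg_left h3 hfac.le)
    rw [mul_add]
    exact add_le_add (mul_le_mul_of_nonneg_left hV hfac.le) hS
  refine (mul_le_mul_of_nonneg_left (div_le_div_of_nonneg_right h1 hD2.le)
    (by positivity)).trans (le_of_eq ?_)
  field_simp

end PermutationTest

/-! ### Dyadic levels and numerical constants. -/

section Calibration

/-- The dyadic grid reaches n², the a priori bound for m₀ in the main proof. -/
theorem sq_le_two_pow_numTests {n : ℕ} (hn : 0 < n) : n ^ 2 ≤ 2 ^ numTests n := by
  have hn0 : (0 : ℝ) < n := by exact_mod_cast hn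
  have h1 : (n : ℝ) ^ 2 ≤ 2 ^ numTests n := by
    rw [← Real.rpow_natCast 2]
    calc (n : ℝ) ^ 2 = (2 : ℝ) ^ (2 * Real.logb 2 n) := by
          rw [mul_comm, Real.rpow_mul zero_le_two, Real.rpow_logb two_pos (by norm_num) hn0]
          norm_num
      _ ≤ 2 ^ ((numTests n : ℕ) : ℝ) :=
          Real.rpow_le_rpow_of_exponent_le one_le_two (Nat.le_ceil _)
  exact_mod_cast h1

theorem numTests_le {n : ℕ} (hL : 1 ≤ Real.log n) : (numTests n : ℝ) ≤ 4 * Real.log n := by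
  have h2 := Real.log_two_gt_d9
  have h3 : 0 < Real.log 2 := by linarith
  have h0 : 0 ≤ 2 * Real.logb 2 n := by
    have : 0 ≤ Real.log n / Real.log 2 := div_nonneg (by linarith) h3.le
    simpa [Real.logb] using this
  have h1 : (numTests n : ℝ) < 2 * Real.logb 2 n + 1 := Nat.ceil_lt_add_one h0
  have h4 : Real.logb 2 n ≤ 1.5 * Real.log n := by
    rw [Real.logb, div_le_iff₀ h3]
    nlinarith
  linarith

/-- A dyadic level that is comparable to `m`. -/
theorem exists_dyadic {n m : ℕ} (hm : 1 ≤ m) (hn : 2 ≤ n) (hmn : m ≤ n ^ 2) :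
    ∃ i ∈ Finset.Icc 1 (numTests n), m ≤ 2 ^ i ∧ 2 ^ i ≤ 2 * m := by
  have hg := sq_le_two_pow_numTests (n := n) (by omega)
  -- The maximum with 1 matters only for m = 1, where the logarithm is 0 but the levels start at 1;
  -- the bound 2 ≤ 2m still holds.
  refine ⟨max 1 (Nat.clog 2 m), Finset.mem_Icc.2 ⟨le_max_left _ _, max_le ?_ ?_⟩, ?_, ?_⟩
  · by_contra h0
    have : numTests n = 0 := by omega
    rw [this] at hg
    nlinarith
  · exact Nat.clog_le_of_le_pow (hmn.trans hg)
  · exact (Nat.le_pow_clog one_lt_two m).trans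
      (Nat.pow_le_pow_right two_pos (le_max_right _ _))
  · rcases Nat.eq_zero_or_pos (Nat.clog 2 m) with h0 | h0
    · rw [h0]
      simp only [Nat.zero_le, sup_of_le_left, pow_one]
      omega
    · have hm1 : 1 < m := by
        by_contra h
        have : m = 1 := by omega
        simp [this] at h0
      have h2 := Nat.pow_pred_clog_lt_self one_lt_two hm1
      rw [max_eq_right h0]
      obtain ⟨k, hk⟩ := Nat.exists_eq_succ_of_ne_zero h0.ne'
      rw [hk] at h2 ⊢
      simp only [Nat.pred_succ] at h2
      rw [pow_succ]
      omega

theorem card_truncationSet {J K : Type*} (ω : ℕ+ ↪ J × K) (m : ℕ+) :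
    (truncationSet ω m).card = m := by
  simp [truncationSet]

/-- The error probability at the chosen level is at most `β`. -/
theorem error_bound {α β g B q : ℝ} (hα : 0 < α) (hβ : 0 < β) (hαβ : α * β ≤ 1 / 2) (hg : 1 ≤ g)
    (hB0 : 0 ≤ B) (hB : 2 * (g / (α * β) - 1) ≤ B) (hq : g * q ≤ α * β / 3) :
    (1 + B * q) / (1 + B) / (α / g) ≤ β := by
  have hB1 : 0 < 1 + B := by linarith
  have hab : 0 < α * β := mul_pos hα hβ
  have h1 : 2 * g - 2 * (α * β) ≤ α * β * B := by
    have := mul_le_mul_of_nonneg_left hB hab.le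
    have e : α * β * (2 * (g / (α * β) - 1)) = 2 * g - 2 * (α * β) := by
      field_simp
    linarith
  rw [div_le_iff₀ (by positivity), div_le_iff₀ hB1, mul_assoc, ← sub_nonneg]
  have h2 : β * (α / g * (1 + B)) - (1 + B * q) = (α * β * (1 + B) - g - B * (g * q)) / g := by
    field_simp
    ring
  rw [h2]
  refine div_nonneg ?_ (by linarith)
  -- Inserting `hq` and then `h1` bounds the numerator below by (g - αβ)/3, which is nonnegative
  -- since αβ ≤ 1/2 and 1 ≤ g.
  nlinarith [mul_le_mul_of_nonneg_left hq hB0]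

/-- The numerical core: the separation condition makes the exceedance probability small. -/
theorem exceedance_bound {A n D ρ C L m k : ℝ} (hA : 1 ≤ A) (hn : 0 < n)
    (hC : 1 ≤ C) (hL : 0 < L) (hρ : 0 < ρ) (hD : ρ ^ 2 / 2 ≤ D) (hk0 : 0 ≤ k) (hk : k ≤ 2 * m)
    (h1 : C ^ 2 * L ≤ n * ρ ^ 2) (h2 : C ^ 4 * (L * m) ≤ n ^ 2 * ρ ^ 4) :
    2 ^ 16 * A ^ 2 / (n * D) + 2 ^ 23 * A ^ 4 * k / (n ^ 2 * D ^ 2) ≤ 2 ^ 28 * A ^ 4 / (C * L) := by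
  have hC0 : 0 < C := by linarith
  have hD0 : 0 < D := by
    have := pow_pos hρ 2
    linarith
  have hA4 : A ^ 2 ≤ A ^ 4 := pow_le_pow_right₀ hA (by norm_num)
  -- The hypotheses supply C² and C⁴; a single power of C suffices in the conclusion.
  have hCL : C * L ≤ C ^ 2 * L := by
    have : C ≤ C ^ 2 := by nlinarith
    exact mul_le_mul_of_nonneg_right this hL.le
  have b1 : 2 ^ 16 * A ^ 2 / (n * D) ≤ 2 ^ 17 * A ^ 4 / (C * L) := by
    rw [div_le_div_iff₀ (by positivity) (by positivity)]
    have e1 : C * L ≤ 2 * (n * D) := by nlinarith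
    have : A ^ 2 * (C * L) ≤ A ^ 4 * (2 * (n * D)) :=
      mul_le_mul hA4 e1 (by positivity) (by positivity)
    linarith
  have b2 : 2 ^ 23 * A ^ 4 * k / (n ^ 2 * D ^ 2) ≤ 2 ^ 26 * A ^ 4 / (C * L) := by
    rw [div_le_div_iff₀ (by positivity) (by positivity)]
    have e0 : ρ ^ 4 ≤ 4 * D ^ 2 := by
      have := pow_le_pow_left₀ (by positivity) hD 2
      nlinarith
    have e1 : C * L * k ≤ 8 * (n ^ 2 * D ^ 2) := by
      have c4 : C ≤ C ^ 4 := by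
        simpa using pow_le_pow_right₀ hC (show 1 ≤ 4 by norm_num)
      have hm : 0 ≤ m := by linarith
      calc C * L * k ≤ C * L * (2 * m) := by gcongr
        _ = 2 * (C * (L * m)) := by ring
        _ ≤ 2 * (C ^ 4 * (L * m)) := by gcongr
        _ ≤ 2 * (n ^ 2 * (4 * D ^ 2)) := by nlinarith [mul_le_mul_of_nonneg_left e0 (sq_nonneg n)]
        _ = _ := by ring
    have := mul_le_mul_of_nonneg_left e1 (show 0 ≤ 2 ^ 23 * A ^ 4 by positivity)
    linarith
  have b3 : 0 ≤ A ^ 4 / (C * L) := by positivity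
  calc _ ≤ 2 ^ 17 * A ^ 4 / (C * L) + 2 ^ 26 * A ^ 4 / (C * L) := add_le_add b1 b2
    _ ≤ 2 ^ 28 * A ^ 4 / (C * L) := by
      simp only [mul_div_assoc] at b3 ⊢
      linarith

end Calibration

end

end USP

/-! ### Choice of the constant and of the level. -/

theorem mainTheorem12 (α β R₀ θ₀ A : ℝ) (hα : 0 < α) (hα1 : α < 1) (hβ : 0 < β)
    (hβ1 : β < 1 - α) (hR₀ : 0 < R₀) (hθ₀ : 0 < θ₀) (hA : 1 ≤ A) :
    ∃ C : ℝ, 0 < C ∧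
      ∀ (𝒳 𝒴 J K : Type*) [MeasurableSpace 𝒳] [MeasurableSpace 𝒴] [Countable J] [Countable K]
        (μX : Measure 𝒳) (μY : Measure 𝒴) [SigmaFinite μX] [SigmaFinite μY]
        [IsSeparable μX] [IsSeparable μY]
        (pX : J → 𝒳 → ℝ) (pY : K → 𝒴 → ℝ)
        (_ : USP.IsONBasisL2 μX pX) (_ : USP.IsONBasisL2 μY pY)
        (ω : ℕ+ ↪ J × K) (θ : J × K → ℝ≥0∞) (_ : USP.IsOrderedWeight ω θ₀ θ)
        (r ρ : ℝ) (_ : 0 < r) (_ : r ≤ R₀) (_ : 0 < ρ)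
        (f : 𝒳 × 𝒴 → ℝ) (_ : USP.IsAlternative μX μY pX pY θ r A ρ f)
        (n B : ℕ) (_ : C ≤ (n : ℝ))
        (_ : 2 * ((USP.numTests n : ℝ) / (α * β) - 1) ≤ (B : ℝ))
        (_ : C * max
            (Real.log n ^ (1 / 4 : ℝ) / (n : ℝ) ^ (1 / 2 : ℝ) *
              (USP.m₀ ω θ ((n : ℝ) * r ^ 2 / Real.log n ^ (1 / 2 : ℝ)) : ℝ) ^ (1 / 4 : ℝ))
            (Real.log n ^ (1 / 2 : ℝ) / (n : ℝ) ^ (1 / 2 : ℝ)) ≤ ρ)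
        (Ω : Type*) [MeasurableSpace Ω] (P : Measure Ω) [IsProbabilityMeasure P]
        (Z : Fin n → Ω → 𝒳 × 𝒴) (_ : USP.IsIIDSample P μX μY f Z)
        (perm : ℕ → Fin B → Ω → Equiv.Perm (Fin n))
        (_ : ∀ i ∈ Finset.Icc 1 (USP.numTests n), USP.IsUniformPerms P Z (perm i)),
        1 - β ≤ P.real {w | USP.AdaptiveReject pX pY ω α (fun k => Z k w)
          (fun i b => perm i b w)} := by
  have hαβ0 : 0 < α * β := mul_pos hα hβ
  have hαβ : α * β ≤ 1 / 2 := by nlinarith [sq_nonneg (α - 1 / 2)]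
  have hA4 : 0 < A ^ 4 := by positivity
  -- The term 8 gives n ≥ 6 and log n ≥ 1; the exponential gives log n > (R₀/θ₀)⁴, which yields m₀ ≤
  -- n²; the last term makes γ q at most αβ/3.
  set C : ℝ := 8 + Real.exp ((R₀ / θ₀) ^ 4) + 2 ^ 32 * A ^ 4 / (α * β) with hCdef
  have he := Real.exp_pos ((R₀ / θ₀) ^ 4)
  have hc0 : 0 < 2 ^ 32 * A ^ 4 / (α * β) := by positivity
  have hC8 : 8 ≤ C := by linarith
  have hCexp : Real.exp ((R₀ / θ₀) ^ 4) < C := by linarith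
  have hCbig : 2 ^ 32 * A ^ 4 / (α * β) ≤ C := by linarith
  clear_value C
  refine ⟨C, by linarith, ?_⟩
  intro 𝒳 𝒴 J K _ _ _ _ μX μY _ _ _ _ pX pY hX hY ω θ hθ r ρ hr hrR hρ f hf n B hn hB hsep
    Ω _ P _ Z hZ perm hperm
  have hn8 : (8 : ℝ) ≤ n := hC8.trans hn
  have hnN : 8 ≤ n := by exact_mod_cast hn8
  have hn0 : (0 : ℝ) < n := by linarith
  set L := Real.log n with hLdef
  have hL1 : 1 ≤ L := by
    rw [hLdef, Real.le_log_iff_exp_le hn0]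
    linarith [Real.exp_one_lt_d9]
  have hLR : (R₀ / θ₀) ^ 4 < L := by
    rw [hLdef, Real.lt_log_iff_exp_lt hn0]
    linarith
  have hL0 : 0 < L := by linarith
  -- With a, w and u standing for (log n)^{1/4}, n^{1/2} and m₀^{1/4}, the fractional powers become
  -- integer powers and the rest is polynomial arithmetic.
  set a : ℝ := L ^ (1 / 4 : ℝ) with ha
  have ha0 : 0 < a := Real.rpow_pos_of_pos hL0 _
  have ha4 : a ^ 4 = L := by
    rw [ha, ← Real.rpow_natCast, ← Real.rpow_mul hL0.le]
    norm_num
  have ha2 : L ^ (1 / 2 : ℝ) = a ^ 2 := by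
    rw [ha, ← Real.rpow_natCast, ← Real.rpow_mul hL0.le]
    norm_num
  have hw : (n : ℝ) ^ (1 / 2 : ℝ) = Real.sqrt n := (Real.sqrt_eq_rpow _).symm
  rw [ha2, hw] at hsep
  set w := Real.sqrt n with hwdef
  have hw0 : 0 < w := Real.sqrt_pos.2 hn0
  have hw2 : w ^ 2 = n := Real.sq_sqrt hn0.le
  set t : ℝ := n * r ^ 2 / a ^ 2 with ht
  have ht0 : 0 < t := by positivity
  -- At m = n² the requirement is n r²/√(log n) < n θ₀², which holds because r ≤ R₀ and log n >
  -- (R₀/θ₀)⁴.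
  have htN : t < Real.sqrt ((⟨n ^ 2, by positivity⟩ : ℕ+) : ℕ) * θ₀ ^ 2 := by
    have h1 : Real.sqrt ((⟨n ^ 2, by positivity⟩ : ℕ+) : ℕ) = n := by
      simp [Real.sqrt_sq hn0.le]
    have h2 : (R₀ / θ₀) ^ 2 < a ^ 2 := by
      refine lt_of_pow_lt_pow_left₀ 2 (by positivity) ?_
      rw [← pow_mul, ← pow_mul, ha4]
      exact hLR
    rw [div_pow, div_lt_iff₀ (by positivity)] at h2
    rw [h1, ht, div_lt_iff₀ (by positivity), mul_assoc]
    have h3 : r ^ 2 ≤ R₀ ^ 2 := pow_le_pow_left₀ hr.le hrR 2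
    refine mul_lt_mul_of_pos_left ?_ hn0
    linarith
  obtain ⟨hm0le, k, hk, hkt⟩ := hθ.m₀_spec _ htN hθ₀
  set m := USP.m₀ ω θ t with hm
  have hm1 : 1 ≤ m := hk ▸ k.pos
  obtain ⟨i, hi, hmi, him⟩ := USP.exists_dyadic hm1 (by omega) hm0le
  set u : ℝ := (m : ℝ) ^ (1 / 4 : ℝ) with hu
  have hmR : (1 : ℝ) ≤ m := by exact_mod_cast hm1
  have hu0 : 0 < u := Real.rpow_pos_of_pos (by linarith) _
  have hu4 : u ^ 4 = m := by
    rw [hu, ← Real.rpow_natCast, ← Real.rpow_mul (by linarith)]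
    norm_num
  have hu2 : Real.sqrt m = u ^ 2 := by
    rw [Real.sqrt_eq_rpow, hu, ← Real.rpow_natCast, ← Real.rpow_mul (by linarith)]
    norm_num
  have hs1 : C * (a * u) ≤ ρ * w := by
    have h1 := (mul_le_mul_of_nonneg_left (le_max_left (a / w * u) (a ^ 2 / w))
      (by linarith : 0 ≤ C)).trans hsep
    rw [show C * (a / w * u) = C * (a * u) / w by ring, div_le_iff₀ hw0] at h1
    exact h1
  have hs2 : C * a ^ 2 ≤ ρ * w := by
    have h1 := (mul_le_mul_of_nonneg_left (le_max_right (a / w * u) (a ^ 2 / w))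
      (by linarith : 0 ≤ C)).trans hsep
    rw [show C * (a ^ 2 / w) = C * a ^ 2 / w by ring, div_le_iff₀ hw0] at h1
    exact h1
  have hC0 : 0 < C := by linarith
  have hs1sq : C ^ 2 * (a ^ 2 * u ^ 2) ≤ ρ ^ 2 * n := by
    have h1 := pow_le_pow_left₀ (by positivity) hs1 2
    rw [mul_pow, mul_pow, mul_pow, hw2] at h1
    exact h1
  have h1 : C ^ 2 * L ≤ n * ρ ^ 2 := by
    have h1 := pow_le_pow_left₀ (by positivity) hs2 2
    rw [mul_pow, mul_pow, hw2, ← pow_mul, ha4] at h1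
    linarith
  have h2 : C ^ 4 * (L * m) ≤ (n : ℝ) ^ 2 * ρ ^ 4 := by
    have h1 := pow_le_pow_left₀ (by positivity) hs1sq 2
    rw [← ha4, ← hu4]
    calc C ^ 4 * (a ^ 4 * u ^ 4) = (C ^ 2 * (a ^ 2 * u ^ 2)) ^ 2 := by ring
      _ ≤ (ρ ^ 2 * n) ^ 2 := h1
      _ = _ := by ring
  have hA0 : 0 ≤ A := by linarith
  have hdom := hZ.isDominatedSample hf.isDensity hA0 hf.supNorm_le hf.supNorm_marginalX_le
    hf.supNorm_marginalY_le
  have hmean := hZ.hasCovMean hf.isDensity hdom hA hX hY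
  set M := USP.truncationSet ω (2 ^ i) with hM
  have hcard : M.card = 2 ^ i := by
    rw [hM, USP.card_truncationSet]
    simp
  have hMne : M.Nonempty := by
    rw [← Finset.card_pos, hcard]
    positivity
  have hkm : k ≤ 2 ^ i := by
    rw [← PNat.coe_le_coe, hk]
    simpa using hmi
  -- Taking s = √m₀ makes the truncation loss √m₀ r²/t = a²u²/n; the factor r² cancels, and `hs1sq`
  -- bounds the result by ρ²/C².
  have hdep := hf.dependence_le hX hY hA0 hθ ht0 hkm (Real.sqrt_nonneg m) hkt.le
  rw [← hM] at hdep
  set D := ∑ jk ∈ M, USP.dependenceCoeff μX μY pX pY f jk ^ 2 with hD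
  have hDρ : ρ ^ 2 / 2 ≤ D := by
    have e1 : Real.sqrt m / t * r ^ 2 = a ^ 2 * u ^ 2 / n := by
      rw [hu2, ht]
      field_simp
    have e2 : a ^ 2 * u ^ 2 / n ≤ ρ ^ 2 / 2 := by
      rw [div_le_div_iff₀ hn0 two_pos]
      have hC2 : 2 ≤ C ^ 2 := (by linarith : 2 ≤ C).trans (le_self_pow₀ (by linarith) two_ne_zero)
      have h3 := mul_le_mul_of_nonneg_right hC2 (by positivity : 0 ≤ a ^ 2 * u ^ 2)
      linarith
    have := hf.le_dependence
    linarith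
  have hDpos : 0 < D := lt_of_lt_of_le (by positivity) hDρ
  have hq := fun b => hdom.measureReal_Dhat_le hA hX hY hMne hmean (by omega) hDpos (hperm i hi) b
  have hk2 : (M.card : ℝ) ≤ 2 * m := by
    rw [hcard]
    exact_mod_cast him
  have hex := USP.exceedance_bound hA hn0 (by linarith) hL0 hρ hDρ (Nat.cast_nonneg M.card) hk2
    h1 h2
  set g : ℝ := (USP.numTests n : ℝ) with hg
  have hg1 : 1 ≤ g := by
    have := (Finset.mem_Icc.1 hi).1.trans (Finset.mem_Icc.1 hi).2
    rw [hg]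
    exact_mod_cast this
  have hgL : g ≤ 4 * L := USP.numTests_le hL1
  -- The number of tests, at most 4 log n, cancels the factor 1/log n gained from the separation
  -- condition; 3 · 2³⁰ ≤ 2³² closes the estimate.
  have hgq : g * (2 ^ 28 * A ^ 4 / (C * L)) ≤ α * β / 3 := by
    refine (mul_le_mul_of_nonneg_right hgL (by positivity)).trans ?_
    rw [show 4 * L * (2 ^ 28 * A ^ 4 / (C * L)) = 2 ^ 30 * A ^ 4 / C by field_simp; ring,
      div_le_div_iff₀ hC0 three_pos]
    rw [div_le_iff₀ hαβ0] at hCbig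
    linarith
  have hmarkov := (hperm i hi).measureReal_le_pValue hZ.measurable hX hY M
    (a := α / g) (by positivity) (fun b => (hq b).trans hex)
  have herr := hmarkov.trans (USP.error_bound hα hβ hαβ hg1 (Nat.cast_nonneg B) hB hgq)
  set bad : Set Ω := {w | α / g ≤ USP.pValue pX pY M (fun k => Z k w) (fun b => perm i b w)}
  set rej : Set Ω := {w | USP.AdaptiveReject pX pY ω α (fun k => Z k w) (fun i b => perm i b w)}
  -- Non-rejection forces the p-value at level `i` to be at least α/γ, so the error at this one
  -- level bounds that of the adaptive test.
  have hcover : (Set.univ : Set Ω) ⊆ rej ∪ bad := by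
    intro w _
    by_cases hw : w ∈ bad
    · exact Or.inr hw
    · exact Or.inl ⟨i, hi, not_le.1 hw⟩
  have hun := (measureReal_mono (μ := P) hcover).trans (measureReal_union_le rej bad)
  rw [probReal_univ] at hun
  linarith
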